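/- **Setting.** Let $d\in\mathbb{N}$, let $\mathbb{S}\subset\mathbb{R}^d$ be nonempty, compact and convex with nearest-point projection $\Pi_{\mathbb{S}}$, and let $L>0$, $M\ge 0$, $m\in\mathbb{R}$, $\epsilon_0>0$, $\epsilon\in(0,\epsilon_0]$ and $\lambda>0$ satisfy $2\lambda\left(L+\frac{M+1}{\epsilon}-\min(m,0)\right)\le 1$. For $i\in\{1,2\}$ let $p^i(x)$ be a prior probability law on $\mathbb{R}^d$, $p^i(y|x)$ a likelihood ($x\in\mathbb{R}^d$, $y\in\mathbb{R}^n$), and $(D^i_{\epsilon'})_{\epsilon'>0}$ a family of maps $\mathbb{R}^d\to\mathbb{R}^d$ (denoisers). Fix an observation $y\in\mathbb{R}^n$ and put $$b^i(x)=\nabla_x\log p^i(y|x)+\tfrac1\epsilon\left(D^i_\epsilon(x)-x\right)+\tfrac1\lambda\left(\Pi_{\mathbb{S}}(x)-x\right).$$ For a step size $\delta>0$ the PnP-ULA chain with drift $b^i$ is $$x_{k+1}=x_k+\delta\, b^i(x_k)+\sqrt{2\delta}\,z_{k+1},\qquad z_k \text{ i.i.d. } \mathcal N(0,I_d).$$ **Assumptions.**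 For $i\in\{1,2\}$: 1. The prior $p^i$ has a finite second moment. 2. For every $y'\in\mathbb{R}^n$, $x\mapsto p^i(y'|x)$ is bounded, of class $C^1$ with values in $(0,\infty)$, and $\nabla_x\log p^i(y'|\cdot)$ is $L$-Lipschitz. 3. For every $\epsilon'\in(0,\epsilon_0]$, $D^i_{\epsilon'}$ is $M$-Lipschitz. 4. For all $x_1,x_2\in\mathbb{R}^d$, $\langle\nabla\log p^i(y|x_2)-\nabla\log p^i(y|x_1),\,x_2-x_1\rangle\le -m\|x_2-x_1\|^2$. **Theorem 1.** Let $\bar\delta=\frac13\left(L+\frac{M+1}{\epsilon}+\frac1\lambda\right)^{-1}$. Under Assumptions 1–4, for every $\delta\in(0,\bar\delta]$ each of the two chains has a unique invariant probability law, denoted $\pi^1_\delta$, resp. $\pi^2_\delta$. With $$d_1(b^1,b^2)=\left(\int_{\mathbb{R}^d}\|b^1(x)-b^2(x)\|^2\,\pi^1_\delta(dx)\right)^{1/2},$$ which is finite, there are constants $A_0,B_0,A_1,B_1\ge 0$ such that for all $\delta\in(0,\bar\delta]$ $$\|\pi^1_\delta-\pi^2_\delta\|_{TV}\le A_0\,d_1(b^1,b^2)+B_0\,\delta^{1/4},\qquad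 W_1(\pi^1_\delta,\pi^2_\delta)\le A_1\,d_1(b^1,b^2)^{1/2}+B_1\,\delta^{1/8}.$$ The constants depend on $d,\mathbb{S},L,M,m,\epsilon_0,\epsilon,\lambda$, and on the drifts only through an upper bound $K$ for $\|b^1(0)\|$ and $\|b^2(0)\|$; in particular they do not depend on $\delta$. Here $\|\mu-\nu\|_{TV}=\sup\left|\int f\,d\mu-\int f\,d\nu\right|$ over measurable $f$ with $|f|\le1$, and $W_1(\mu,\nu)$ is the infimum of $\int\|x_1-x_2\|\,d\gamma(x_1,x_2)$ over couplings $\gamma$ of $\mu$ and $\nu$. -/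

import Mathlib

open MeasureTheory ProbabilityTheory
open scoped ENNReal NNReal

noncomputable section

namespace PnPULA

/-- `ℝ^d` with its Euclidean norm. -/
abbrev Vec (d : ℕ) : Type := EuclideanSpace ℝ (Fin d)

/-! ### Assumptions -/

/-- A law on `ℝ^d` has a finite second moment. -/
def FiniteSecondMoment {d : ℕ} (p : Measure (Vec d)) : Prop :=
  ∫⁻ x, ‖x‖ₑ ^ 2 ∂p < ∞

/-- The likelihood score `x ↦ ∇ₓ log p(y|x)`; here `p y x` stands for `p(y|x)`. -/
def score {n d : ℕ} (p : Vec n → Vec d → ℝ) (y : Vec n) : Vec d → Vec d :=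
  gradient (fun x => Real.log (p y x))

/-- For every observation `y`, the likelihood `p(y|·)` is bounded, positive and `C¹`, and its score
is `L`-Lipschitz. -/
structure SmoothLikelihood {n d : ℕ} (L : ℝ) (p : Vec n → Vec d → ℝ) : Prop where
  bounded : ∀ y, BddAbove (Set.range (p y))
  pos : ∀ y x, 0 < p y x
  contDiff : ∀ y, ContDiff ℝ 1 (p y)
  lipschitz : ∀ y x₁ x₂, ‖score p y x₁ - score p y x₂‖ ≤ L * ‖x₁ - x₂‖

/-- The denoisers `D ε`, for all noise levels `ε ∈ (0, ε₀]`, are `M`-Lipschitz. -/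
def LipschitzDenoiser {d : ℕ} (ε₀ M : ℝ) (D : ℝ → Vec d → Vec d) : Prop :=
  ∀ ε, 0 < ε → ε ≤ ε₀ → ∀ x₁ x₂, ‖D ε x₁ - D ε x₂‖ ≤ M * ‖x₁ - x₂‖

/-- The likelihood score at the observation `y` is one-sided Lipschitz with constant `-m`. -/
def OneSidedLipschitzScore {n d : ℕ} (m : ℝ) (p : Vec n → Vec d → ℝ) (y : Vec n) : Prop :=
  ∀ x₁ x₂, inner ℝ (score p y x₂ - score p y x₁) (x₂ - x₁) ≤ -m * ‖x₂ - x₁‖ ^ 2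

/-! ### The chain -/

/-- The nearest-point projection onto `S` (well defined for `S` nonempty, compact and convex). -/
def proj {d : ℕ} (S : Set (Vec d)) (x : Vec d) : Vec d :=
  Classical.epsilon fun p => p ∈ S ∧ dist x p = Metric.infDist x S

theorem proj_spec {d : ℕ} {S : Set (Vec d)} (hS : IsCompact S) (hne : S.Nonempty) (x : Vec d) :
    proj S x ∈ S ∧ dist x (proj S x) = Metric.infDist x S := by
  obtain ⟨p, hp, hd⟩ := hS.exists_infDist_eq_dist hne x
  exact Classical.epsilon_spec (p := fun p => p ∈ S ∧ dist x p = Metric.infDist x S) ⟨p, hp, hd.symm⟩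

/-- The drift `b_ε(x) = ∇ log p(y|x) + (D_ε(x) - x) / ε + (Π_S(x) - x) / λ`. -/
def drift {n d : ℕ} (p : Vec n → Vec d → ℝ) (y : Vec n) (D : ℝ → Vec d → Vec d)
    (S : Set (Vec d)) (ε lam : ℝ) (x : Vec d) : Vec d :=
  score p y x + (1 / ε) • (D ε x - x) + (1 / lam) • (proj S x - x)

/-- The law of `x + δ b(x) + √(2δ) z` with `z` standard Gaussian: one step of the chain from `x`. -/
def transition {d : ℕ} (b : Vec d → Vec d) (δ : ℝ) (x : Vec d) : Measure (Vec d) :=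
  (stdGaussian (Vec d)).map fun z => x + δ • b x + √(2 * δ) • z

/-- `π` is an invariant probability law of the chain with drift `b` and step size `δ`. -/
def IsInvariantLaw {d : ℕ} (b : Vec d → Vec d) (δ : ℝ) (π : Measure (Vec d)) : Prop :=
  IsProbabilityMeasure π ∧
    ∀ A : Set (Vec d), MeasurableSet A → ∫⁻ x, transition b δ x A ∂π = π A

/-! ### Distances -/

/-- `‖μ - ν‖_TV`, the supremum of `|∫ f dμ - ∫ f dν|` over measurable `f` with `|f| ≤ 1`. -/
def tvDist {d : ℕ} (μ ν : Measure (Vec d)) : ℝ≥0∞ :=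
  ⨆ (f : Vec d → ℝ) (_ : Measurable f) (_ : ∀ x, |f x| ≤ 1),
    ENNReal.ofReal |∫ x, f x ∂μ - ∫ x, f x ∂ν|

/-- The Wasserstein-1 distance, the infimum of the transport cost over all couplings. -/
def wasserstein {d : ℕ} (μ ν : Measure (Vec d)) : ℝ≥0∞ :=
  ⨅ (γ : Measure (Vec d × Vec d)) (_ : γ.map Prod.fst = μ) (_ : γ.map Prod.snd = ν),
    ∫⁻ z, ‖z.1 - z.2‖ₑ ∂γ

/-- The `L²` distance `(∫ ‖f₁ - f₂‖² dπ)^(1/2)`: the posterior-`L₂` pseudometric when `π` is the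
invariant law of the first chain. -/
def posteriorL2 {d : ℕ} (π : Measure (Vec d)) (f₁ f₂ : Vec d → Vec d) : ℝ≥0∞ :=
  (∫⁻ x, ‖f₁ x - f₂ x‖ₑ ^ 2 ∂π) ^ (1 / 2 : ℝ)

end PnPULA

end

namespace PnPULA

/-! ### The Donsker–Varadhan inequality for Gaussian shifts -/

/-! The smallness of `lam` gives `L + (M+1)/ε ≤ 1/(2 lam)`. The linear pull `-x/lam` therefore beats
the Lipschitz part of the drift, and the projection only adds a bounded error. One step thus
satisfies `‖T x - T y‖ ≤ (1 - aδ)‖x - y‖ + δB` with `a = 1/(2 lam)` and `B = diam S / lam`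
(`contractiveDrift_drift`).

A Harris-type argument turns this into a contraction whose rate does not depend on `δ`. Over a block
of about `1/(aδ)` steps, synchronous coupling halves distances up to `B/a`. Points at bounded
distance are merged by the Gaussian noise at bounded entropic cost (`log_harnack`), so their laws
after a block overlap by a fixed amount. Both effects combine on functions of oscillation at most `1
+ β‖x - y‖`. These are exactly the sums of a `β`-Lipschitz function and a function with values in
`[0,1]`, and a block contracts this class by the factor `1 - β` (`abs_block_sub_le`). Existence,
uniqueness and convergence to the invariant law follow, together with a second-moment bound from a
Lyapunov inequality.

For stability, integrate a test function against the invariant law of the first chain and run one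
block of the second chain. The Lipschitz part changes by a multiple of the mean of `‖b - b'‖`. The
unit part is handled by a discrete Girsanov estimate and Pinsker's inequality: each step costs
entropy `δ/4 ‖b - b'‖²`. Summing over blocks against the geometric contraction gives a bound linear
in the `L²` distance of the drifts (`IsInvariantLaw.abs_integral_sub_integral_le`). The two discrete
chains are compared directly, without passing through a diffusion, so no power of `δ` is lost and
`B₀ = B₁ = 0`. The Wasserstein bound follows from the total variation bound and the second moments
(`wasserstein_le`).

Entropy enters only through its dual form, `∫ f dμ ≤ log ∫ exp f dν + C`, which composes along
transition operators without path measures. -/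

theorem integrable_exp_inner_stdGaussian {d : ℕ} (v : Vec d) :
    Integrable (fun z => Real.exp (inner ℝ v z)) (stdGaussian (Vec d)) := by
  rw [← map_pi_eq_stdGaussian, integrable_map_measure (by fun_prop) (by fun_prop)]
  have h := Integrable.fintype_prod (μ := fun _ : Fin d => gaussianReal 0 1)
    (f := fun i x => Real.exp (v i * x)) fun i => integrable_exp_mul_gaussianReal (v i)
  refine h.congr (ae_of_all _ fun x => ?_)
  simp [PiLp.inner_apply, Real.exp_sum, mul_comm]

/-- The characteristic function of the exponentially tilted Gaussian, up to normalization; it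
factors over coordinates into one-dimensional complex moment generating functions. -/
theorem integral_cexp_stdGaussian {d : ℕ} (v t : Vec d) :
    ∫ z, Complex.exp (inner ℝ v z + inner ℝ t z * Complex.I) ∂(stdGaussian (Vec d)) =
      Complex.exp (∑ i, ((v i : ℂ) + t i * Complex.I) ^ 2 / 2) := by
  rw [← map_pi_eq_stdGaussian, integral_map (by fun_prop) (by fun_prop)]
  have h := integral_fintype_prod_eq_prod (𝕜 := ℂ) (μ := fun _ : Fin d => gaussianReal 0 1)
    (f := fun i (x : ℝ) => Complex.exp (((v i : ℂ) + t i * Complex.I) * x))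
  have h1 (i : Fin d) : ∫ x : ℝ, Complex.exp (((v i : ℂ) + t i * Complex.I) * x)
      ∂(gaussianReal 0 1) = Complex.exp (((v i : ℂ) + t i * Complex.I) ^ 2 / 2) := by
    simpa [complexMGF] using
      complexMGF_gaussianReal (p := gaussianReal 0 1) (X := id) (μ := 0) (v := 1) (by simp)
        ((v i : ℂ) + t i * Complex.I)
  simp_rw [h1, ← Complex.exp_sum] at h
  rw [← h]
  congr 1 with x
  congr 1
  simp only [PiLp.inner_apply, RCLike.inner_apply, conj_trivial, Complex.ofReal_sum,
    Complex.ofReal_mul, Finset.sum_mul, ← Finset.sum_add_distrib]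
  exact Finset.sum_congr rfl fun i _ => by ring

/-- The Cameron–Martin formula. -/
theorem stdGaussian_map_add {d : ℕ} (v : Vec d) :
    (stdGaussian (Vec d)).map (fun z => z + v) =
      (stdGaussian (Vec d)).withDensity
        fun z => ENNReal.ofReal (Real.exp (inner ℝ v z - ‖v‖ ^ 2 / 2)) := by
  have hint : Integrable (fun z => Real.exp (inner ℝ v z - ‖v‖ ^ 2 / 2)) (stdGaussian (Vec d)) := by
    simp_rw [Real.exp_sub]
    exact (integrable_exp_inner_stdGaussian v).div_const _
  have : IsProbabilityMeasure ((stdGaussian (Vec d)).map (fun z => z + v)) :=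
    Measure.isProbabilityMeasure_map (by fun_prop)
  have : IsFiniteMeasure ((stdGaussian (Vec d)).withDensity
      fun z => ENNReal.ofReal (Real.exp (inner ℝ v z - ‖v‖ ^ 2 / 2))) :=
    isFiniteMeasure_withDensity_ofReal hint.2
  -- Both sides are finite measures, so comparing characteristic functions suffices.
  apply Measure.ext_of_charFun
  ext t
  rw [charFun_apply, charFun_apply, integral_map (by fun_prop) (by fun_prop),
    integral_withDensity_eq_integral_toReal_smul (by fun_prop) (by simp)]
  have h0 := charFun_stdGaussian (E := Vec d) t
  rw [charFun_apply] at h0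
  have hv : ((‖v‖ : ℂ)) ^ 2 = ∑ i, (v i : ℂ) ^ 2 := by
    exact_mod_cast congrArg (fun r : ℝ => (r : ℂ)) (EuclideanSpace.real_norm_sq_eq v)
  have ht : ((‖t‖ : ℂ)) ^ 2 = ∑ i, (t i : ℂ) ^ 2 := by
    exact_mod_cast congrArg (fun r : ℝ => (r : ℂ)) (EuclideanSpace.real_norm_sq_eq t)
  have hl : ∀ z : Vec d, Complex.exp (inner ℝ (z + v) t * Complex.I) =
      Complex.exp (inner ℝ v t * Complex.I) * Complex.exp (inner ℝ z t * Complex.I) := by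
    intro z
    rw [← Complex.exp_add, inner_add_left]
    push_cast
    ring_nf
  have hr : ∀ z : Vec d, (ENNReal.ofReal (Real.exp (inner ℝ v z - ‖v‖ ^ 2 / 2))).toReal •
      Complex.exp (inner ℝ z t * Complex.I) = Complex.exp (-‖v‖ ^ 2 / 2) *
        Complex.exp (inner ℝ v z + inner ℝ t z * Complex.I) := by
    intro z
    rw [ENNReal.toReal_ofReal (Real.exp_nonneg _), Complex.real_smul, Complex.ofReal_exp,
      ← Complex.exp_add, ← Complex.exp_add, real_inner_comm z t]
    push_cast
    ring_nf
  simp_rw [hl, hr, integral_const_mul]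
  rw [h0, integral_cexp_stdGaussian, ← Complex.exp_add, ← Complex.exp_add, hv, ht]
  congr 1
  simp only [PiLp.inner_apply, RCLike.inner_apply, conj_trivial, Complex.ofReal_sum,
    Complex.ofReal_mul, Finset.sum_mul, ← Finset.sum_add_distrib, ← Finset.sum_neg_distrib,
    Finset.sum_div]
  refine Finset.sum_congr rfl fun i _ => ?_
  linear_combination ((t i : ℂ) ^ 2 / 2) * (- Complex.I_sq)

theorem integral_stdGaussian_shift {d : ℕ} (v : Vec d) {F : Vec d → ℝ} (hF : Measurable F) :
    ∫ z, F z ∂(stdGaussian (Vec d)) =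
      ∫ z, Real.exp (-inner ℝ v z - ‖v‖ ^ 2 / 2) * F (z + v) ∂(stdGaussian (Vec d)) := by
  have h : ∫ z, F (z + v) ∂((stdGaussian (Vec d)).map (fun z => z + -v)) =
      ∫ z, F z ∂(stdGaussian (Vec d)) := by
    have hFv : Measurable fun z => F (z + v) := hF.comp (by fun_prop)
    rw [integral_map (by fun_prop) hFv.aestronglyMeasurable]
    simp
  rw [← h, stdGaussian_map_add, integral_withDensity_eq_integral_toReal_smul (by fun_prop)
    (by simp)]
  simp [Real.exp_nonneg]

/-- A function to which the transition operators apply: measurable and bounded. -/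
structure BddMeasurable {d : ℕ} (f : Vec d → ℝ) : Prop where
  measurable : Measurable f
  bounded : ∃ C, ∀ x, |f x| ≤ C

namespace BddMeasurable

variable {d : ℕ} {f g : Vec d → ℝ}

theorem integrable (hf : BddMeasurable f) (μ : Measure (Vec d)) [IsFiniteMeasure μ] :
    Integrable f μ := by
  obtain ⟨C, hC⟩ := hf.bounded
  exact Integrable.of_bound hf.measurable.aestronglyMeasurable C
    (ae_of_all _ fun x => by simpa using hC x)

theorem comp (hf : BddMeasurable f) {T : Vec d → Vec d} (hT : Measurable T) :
    BddMeasurable fun x => f (T x) :=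
  ⟨hf.measurable.comp hT, hf.bounded.imp fun _ h _ => h _⟩

theorem add (hf : BddMeasurable f) (hg : BddMeasurable g) : BddMeasurable fun x => f x + g x := by
  obtain ⟨C, hC⟩ := hf.bounded
  obtain ⟨C', hC'⟩ := hg.bounded
  exact ⟨hf.measurable.add hg.measurable, C + C', fun x =>
    (abs_add_le _ _).trans (add_le_add (hC x) (hC' x))⟩

theorem const_mul (hf : BddMeasurable f) (c : ℝ) : BddMeasurable fun x => c * f x := by
  obtain ⟨C, hC⟩ := hf.bounded
  refine ⟨hf.measurable.const_mul c, |c| * C, fun x => ?_⟩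
  rw [abs_mul]
  exact mul_le_mul_of_nonneg_left (hC x) (abs_nonneg c)

theorem const (c : ℝ) : BddMeasurable fun _ : Vec d => c :=
  ⟨measurable_const, |c|, fun _ => le_rfl⟩

theorem sub (hf : BddMeasurable f) (hg : BddMeasurable g) : BddMeasurable fun x => f x - g x := by
  simpa [sub_eq_add_neg] using hf.add (hg.const_mul (-1))

theorem exp (hf : BddMeasurable f) : BddMeasurable fun x => Real.exp (f x) := by
  obtain ⟨C, hC⟩ := hf.bounded
  refine ⟨hf.measurable.exp, Real.exp C, fun x => ?_⟩
  rw [abs_of_pos (Real.exp_pos _)]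
  exact Real.exp_le_exp.2 ((le_abs_self _).trans (hC x))

end BddMeasurable

theorem integral_le_log_integral_exp {d : ℕ} (μ : Measure (Vec d)) [IsProbabilityMeasure μ]
    {f : Vec d → ℝ} (hf : Integrable f μ) (hexp : Integrable (fun x => Real.exp (f x)) μ) :
    ∫ x, f x ∂μ ≤ Real.log (∫ x, Real.exp (f x) ∂μ) := by
  have h := convexOn_exp.map_integral_le (μ := μ) (f := f) Real.continuous_exp.continuousOn
    isClosed_univ (by simp) hf hexp
  have h' := Real.log_le_log (Real.exp_pos _) h
  rwa [Real.log_exp] at h'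

/-- The Donsker–Varadhan bound for the Gaussian laws `N(u, s² I)` and `N(w, s² I)`. -/
theorem gaussian_integral_le_log {d : ℕ} {s : ℝ} (hs : 0 < s) (u w : Vec d) {f : Vec d → ℝ}
    (hf : BddMeasurable f) :
    ∫ z, f (u + s • z) ∂(stdGaussian (Vec d)) ≤
      Real.log (∫ z, Real.exp (f (w + s • z)) ∂(stdGaussian (Vec d)))
        + ‖u - w‖ ^ 2 / (2 * s ^ 2) := by
  set v : Vec d := s⁻¹ • (u - w) with hv
  have hsv : s • v = u - w := by rw [hv, smul_smul, mul_inv_cancel₀ hs.ne', one_smul]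
  have hfw : Measurable fun z => Real.exp (f (w + s • z)) :=
    (hf.measurable.comp (by fun_prop)).exp
  have hfu : BddMeasurable fun z : Vec d => f (u + s • z) := hf.comp (by fun_prop)
  have hinner : Integrable (fun z => inner ℝ v z) (stdGaussian (Vec d)) :=
    (innerSL ℝ v).integrable_comp IsGaussian.integrable_id
  have hinner0 : ∫ z, inner ℝ v z ∂(stdGaussian (Vec d)) = 0 :=
    integral_strongDual_stdGaussian (innerSL ℝ v)
  have hshift : ∀ z, Real.exp (-inner ℝ v z - ‖v‖ ^ 2 / 2) * Real.exp (f (w + s • (z + v))) =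
      Real.exp (f (u + s • z) - inner ℝ v z - ‖v‖ ^ 2 / 2) := by
    intro z
    rw [← Real.exp_add, show w + s • (z + v) = u + s • z by rw [smul_add, hsv]; abel]
    ring_nf
  have hint : Integrable (fun z => f (u + s • z) - inner ℝ v z - ‖v‖ ^ 2 / 2)
      (stdGaussian (Vec d)) :=
    ((hfu.integrable _).sub hinner).sub (integrable_const _)
  have hexp : Integrable (fun z => Real.exp (f (u + s • z) - inner ℝ v z - ‖v‖ ^ 2 / 2))
      (stdGaussian (Vec d)) := by
    obtain ⟨C, hC⟩ := hfu.exp.bounded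
    have := ((integrable_exp_inner_stdGaussian (-v)).bdd_mul (c := C)
      hfu.exp.measurable.aestronglyMeasurable (ae_of_all _ fun x => by simpa using hC x)).div_const
      (Real.exp (‖v‖ ^ 2 / 2))
    refine this.congr (ae_of_all _ fun z => ?_)
    simp only [inner_neg_left]
    rw [← Real.exp_add, ← Real.exp_sub, sub_eq_add_neg (f _)]
  -- Recentre the exponential moment at `u`. Jensen's inequality then applies; the linear term has
  -- mean zero, so the loss is exactly `‖v‖²/2`, the relative entropy of the two Gaussians.
  rw [integral_stdGaussian_shift v hfw]
  simp_rw [hshift]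
  have h := integral_le_log_integral_exp _ hint hexp
  have h1 : ∫ z, (f (u + s • z) - inner ℝ v z - ‖v‖ ^ 2 / 2) ∂(stdGaussian (Vec d)) =
      ∫ z, f (u + s • z) ∂(stdGaussian (Vec d)) - ‖v‖ ^ 2 / 2 := by
    have e1 := integral_sub ((hfu.integrable (stdGaussian (Vec d))).sub hinner)
      (integrable_const (‖v‖ ^ 2 / 2))
    have e2 := integral_sub (hfu.integrable (stdGaussian (Vec d))) hinner
    simp only [Pi.sub_apply, integral_const, probReal_univ, one_smul] at e1
    rw [e1, e2, hinner0, sub_zero]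
  have h2 : ‖u - w‖ ^ 2 / (2 * s ^ 2) = ‖v‖ ^ 2 / 2 := by
    rw [← hsv, norm_smul, mul_pow, Real.norm_eq_abs, sq_abs]
    field_simp
  rw [h2]
  linarith

end PnPULA

namespace PnPULA

/-! ### The transition operator -/

/-- The transition operator `f ↦ E f(x + δ b(x) + √(2δ) z)` of the chain. -/
noncomputable def evolve {d : ℕ} (b : Vec d → Vec d) (δ : ℝ) (f : Vec d → ℝ) (x : Vec d) : ℝ :=
  ∫ z, f (x + δ • b x + √(2 * δ) • z) ∂(stdGaussian (Vec d))

/-- One step of the chain, as a function of the state and the noise. -/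
noncomputable def chainStep {d : ℕ} (b : Vec d → Vec d) (δ : ℝ) (q : Vec d × Vec d) : Vec d :=
  q.1 + δ • b q.1 + √(2 * δ) • q.2

section evolve

variable {d : ℕ} {b : Vec d → Vec d} {δ : ℝ} {f g : Vec d → ℝ}

theorem measurable_chainStep (hb : Measurable b) : Measurable (chainStep b δ) := by
  unfold chainStep
  fun_prop

theorem measurable_step_right (x : Vec d) :
    Measurable fun z : Vec d => x + δ • b x + √(2 * δ) • z := by fun_prop

theorem evolve_abs_le {C : ℝ} (hC : ∀ x, |f x| ≤ C) (x : Vec d) : |evolve b δ f x| ≤ C := by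
  have h := norm_integral_le_of_norm_le_const (μ := stdGaussian (Vec d)) (C := C)
    (f := fun z => f (x + δ • b x + √(2 * δ) • z)) (ae_of_all _ fun z => by simpa using hC _)
  simpa [evolve] using h

theorem BddMeasurable.evolve (hb : Measurable b) (hf : BddMeasurable f) :
    BddMeasurable (evolve b δ f) := by
  refine ⟨?_, hf.bounded.imp fun C hC => evolve_abs_le hC⟩
  have h : StronglyMeasurable fun q : Vec d × Vec d => f (chainStep b δ q) :=
    (hf.measurable.comp (measurable_chainStep hb)).stronglyMeasurable
  exact (h.integral_prod_right (ν := stdGaussian (Vec d))).measurable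

theorem BddMeasurable.iterate_evolve (hb : Measurable b) (hf : BddMeasurable f) (k : ℕ) :
    BddMeasurable ((PnPULA.evolve b δ)^[k] f) := by
  induction k with
  | zero => exact hf
  | succ k ih => rw [Function.iterate_succ_apply']; exact ih.evolve hb

theorem BddMeasurable.integrable_step (hf : BddMeasurable f) (x : Vec d) :
    Integrable (fun z => f (x + δ • b x + √(2 * δ) • z)) (stdGaussian (Vec d)) :=
  (hf.comp (measurable_step_right x)).integrable _

theorem evolve_mono (hf : BddMeasurable f) (hg : BddMeasurable g) (h : ∀ x, f x ≤ g x)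
    (x : Vec d) : evolve b δ f x ≤ evolve b δ g x :=
  integral_mono (hf.integrable_step x) (hg.integrable_step x) fun _ => h _

@[simp]
theorem evolve_const (c : ℝ) : evolve b δ (fun _ => c) = fun _ => c := by
  ext x
  simp [evolve]

theorem evolve_add (hf : BddMeasurable f) (hg : BddMeasurable g) :
    evolve b δ (fun x => f x + g x) = fun x => evolve b δ f x + evolve b δ g x := by
  ext x
  exact integral_add (hf.integrable_step x) (hg.integrable_step x)

theorem evolve_const_mul (c : ℝ) :
    evolve b δ (fun x => c * f x) = fun x => c * evolve b δ f x := by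
  ext x
  exact integral_const_mul _ _

theorem iterate_evolve_const (c : ℝ) (k : ℕ) :
    (evolve b δ)^[k] (fun _ => c) = fun _ => c := by
  induction k with
  | zero => rfl
  | succ k ih => rw [Function.iterate_succ_apply, evolve_const, ih]

theorem iterate_evolve_mono (hb : Measurable b) (hf : BddMeasurable f) (hg : BddMeasurable g)
    (h : ∀ x, f x ≤ g x) (k : ℕ) (x : Vec d) :
    (evolve b δ)^[k] f x ≤ (evolve b δ)^[k] g x := by
  induction k generalizing x with
  | zero => exact h x
  | succ k ih =>
    rw [Function.iterate_succ_apply', Function.iterate_succ_apply']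
    exact evolve_mono (hf.iterate_evolve hb k) (hg.iterate_evolve hb k) ih x

theorem iterate_evolve_add (hb : Measurable b) (hf : BddMeasurable f) (hg : BddMeasurable g)
    (k : ℕ) : (evolve b δ)^[k] (fun x => f x + g x) =
      fun x => (evolve b δ)^[k] f x + (evolve b δ)^[k] g x := by
  induction k with
  | zero => rfl
  | succ k ih =>
    rw [Function.iterate_succ_apply', ih,
      evolve_add (hf.iterate_evolve hb k) (hg.iterate_evolve hb k),
      Function.iterate_succ_apply', Function.iterate_succ_apply']

theorem iterate_evolve_const_mul (c : ℝ) (k : ℕ) : (evolve b δ)^[k] (fun x => c * f x) =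
      fun x => c * (evolve b δ)^[k] f x := by
  induction k with
  | zero => rfl
  | succ k ih =>
    rw [Function.iterate_succ_apply', ih, evolve_const_mul, Function.iterate_succ_apply']

theorem iterate_evolve_mem_Icc (hb : Measurable b) (hf : BddMeasurable f) {l u : ℝ}
    (h : ∀ x, f x ∈ Set.Icc l u) (k : ℕ) (x : Vec d) :
    (evolve b δ)^[k] f x ∈ Set.Icc l u := by
  constructor
  · have := iterate_evolve_mono (δ := δ) hb (.const l) hf (fun x => (h x).1) k x
    rwa [iterate_evolve_const] at this
  · have := iterate_evolve_mono (δ := δ) hb hf (.const u) (fun x => (h x).2) k x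
    rwa [iterate_evolve_const] at this

theorem iterate_evolve_exp_pos (hb : Measurable b) (hf : BddMeasurable f) (k : ℕ) (x : Vec d) :
    0 < (evolve b δ)^[k] (fun x => Real.exp (f x)) x := by
  obtain ⟨C, hC⟩ := hf.bounded
  have := (iterate_evolve_mem_Icc (δ := δ) hb hf.exp (l := Real.exp (-C)) (u := Real.exp C)
    (fun x => ⟨Real.exp_le_exp.2 (abs_le.1 (hC x)).1, Real.exp_le_exp.2 (abs_le.1 (hC x)).2⟩) k x).1
  exact (Real.exp_pos _).trans_le this

/-- The logarithm of the evolved exponential is bounded and measurable. -/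
theorem BddMeasurable.log_iterate_evolve_exp (hb : Measurable b) (hf : BddMeasurable f) (k : ℕ) :
    BddMeasurable fun x => Real.log ((PnPULA.evolve b δ)^[k] (fun x => Real.exp (f x)) x) := by
  obtain ⟨C, hC⟩ := hf.bounded
  refine ⟨(hf.exp.iterate_evolve hb k).measurable.log, C, fun x => ?_⟩
  have h := iterate_evolve_mem_Icc (δ := δ) hb hf.exp (l := Real.exp (-C)) (u := Real.exp C)
    (fun x => ⟨Real.exp_le_exp.2 (abs_le.1 (hC x)).1, Real.exp_le_exp.2 (abs_le.1 (hC x)).2⟩) k x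
  have hp := iterate_evolve_exp_pos (δ := δ) hb hf k x
  rw [abs_le]
  exact ⟨(Real.le_log_iff_exp_le hp).2 h.1, (Real.log_le_iff_le_exp hp).2 h.2⟩

/-- Comparison of one step of two chains, possibly started at different points and the second one
shifted by `v`. -/
theorem evolve_le_log_evolve_exp {b' : Vec d → Vec d} (hδ : 0 < δ) (hf : BddMeasurable f)
    (x y v : Vec d) :
    ∫ z, f (x + δ • b x + v + √(2 * δ) • z) ∂(stdGaussian (Vec d)) ≤
      Real.log (evolve b' δ (fun x => Real.exp (f x)) y)
        + ‖x + δ • b x + v - (y + δ • b' y)‖ ^ 2 / (4 * δ) := by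
  have h := gaussian_integral_le_log (Real.sqrt_pos.2 (by positivity : 0 < 2 * δ))
    (x + δ • b x + v) (y + δ • b' y) hf
  rw [Real.sq_sqrt (by positivity), show 2 * (2 * δ) = 4 * δ by ring] at h
  exact h

/-- A log-Harnack inequality: if one step moves points apart by at most `η`, two chains started at
distance at most `k h` can be merged in `k` steps at entropic cost `k (h + η)² / (4δ)`. -/
theorem log_harnack (hb : Measurable b) (hδ : 0 < δ) {η h : ℝ} (hη : 0 ≤ η) (hh : 0 < h)
    (hstep : ∀ x y, ‖x + δ • b x - (y + δ • b y)‖ ≤ ‖x - y‖ + η) (hf : BddMeasurable f)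
    (k : ℕ) (x y : Vec d) (hxy : ‖x - y‖ ≤ k * h) :
    (evolve b δ)^[k] f x ≤ Real.log ((evolve b δ)^[k] (fun x => Real.exp (f x)) y)
      + k * ((h + η) ^ 2 / (4 * δ)) := by
  induction k generalizing x y with
  | zero =>
    have : x = y := by
      have : ‖x - y‖ ≤ 0 := by simpa using hxy
      exact sub_eq_zero.1 (norm_le_zero_iff.1 this)
    simp [this]
  | succ k ih =>
    set w : Vec d := y + δ • b y - (x + δ • b x) with hw
    have hwn : ‖w‖ ≤ (k + 1) * h + η := by
      have := hstep y x
      rw [norm_sub_rev y x] at this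
      push_cast at hxy
      linarith
    have hden : 0 < (k + 1) * h + η := by positivity
    -- The gap after the drift step is at most `(k+1)h + η`. The noise closes the fraction `1 - θ`
    -- of it, a shift of length at most `h + η` that is paid for in entropy. The rest has length at
    -- most `k h` and is left to the induction hypothesis.
    set θ : ℝ := k * h / ((k + 1) * h + η) with hθ
    have hθ0 : 0 ≤ θ := by positivity
    have hθ1 : 1 - θ = (h + η) / ((k + 1) * h + η) := by
      rw [hθ]; field_simp; ring
    have hv : ‖θ • w‖ ≤ k * h := by
      rw [norm_smul, Real.norm_of_nonneg hθ0]
      calc θ * ‖w‖ ≤ θ * ((k + 1) * h + η) := by gcongr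
        _ = k * h := by rw [hθ]; field_simp
    have hwv : ‖x + δ • b x + θ • w - (y + δ • b y)‖ ≤ h + η := by
      have e : x + δ • b x + θ • w - (y + δ • b y) = -((1 - θ) • w) := by
        rw [sub_smul, one_smul, hw]; abel
      rw [e, norm_neg, norm_smul, Real.norm_of_nonneg (by rw [hθ1]; positivity), hθ1]
      calc (h + η) / ((k + 1) * h + η) * ‖w‖
          ≤ (h + η) / ((k + 1) * h + η) * ((k + 1) * h + η) := by gcongr
        _ = h + η := by field_simp
    have hlog := hf.log_iterate_evolve_exp (δ := δ) hb k
    rw [Function.iterate_succ_apply', Function.iterate_succ_apply']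
    have h1 : evolve b δ ((evolve b δ)^[k] f) x ≤
        ∫ z, (Real.log ((evolve b δ)^[k] (fun x => Real.exp (f x))
          (x + δ • b x + θ • w + √(2 * δ) • z)) + k * ((h + η) ^ 2 / (4 * δ)))
          ∂(stdGaussian (Vec d)) := by
      refine integral_mono ((hf.iterate_evolve hb k).integrable_step x)
        (((hlog.comp (T := fun z => x + δ • b x + θ • w + √(2 * δ) • z)
          (by fun_prop)).add (.const _)).integrable _) fun z => ih _ _ ?_
      rw [show x + δ • b x + √(2 * δ) • z - (x + δ • b x + θ • w + √(2 * δ) • z) = -(θ • w) by abel,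
        norm_neg]
      exact hv
    rw [integral_add ((hlog.comp (T := fun z => x + δ • b x + θ • w + √(2 * δ) • z)
          (by fun_prop)).integrable _) (integrable_const _)] at h1
    have h2 := evolve_le_log_evolve_exp (b := b) (b' := b) hδ hlog x y (θ • w)
    have h3 : (fun x => Real.exp (Real.log ((evolve b δ)^[k] (fun x => Real.exp (f x)) x))) =
        (evolve b δ)^[k] (fun x => Real.exp (f x)) :=
      funext fun x => Real.exp_log (iterate_evolve_exp_pos hb hf k x)
    rw [h3] at h2
    have h4 : ‖x + δ • b x + θ • w - (y + δ • b y)‖ ^ 2 / (4 * δ) ≤ (h + η) ^ 2 / (4 * δ) := by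
      gcongr
    simp only [integral_const, probReal_univ, one_smul] at h1
    push_cast
    linarith

/-- Two laws at relative entropy at most `C` overlap. -/
theorem sub_le_of_le_log {C p q : ℝ} {E : ℝ → ℝ} (hC : 0 ≤ C) (hq0 : 0 ≤ q) (hp1 : p ≤ 1)
    (hE : ∀ s, 0 ≤ s → E s ≤ 1 + (Real.exp s - 1) * q) (hEpos : ∀ s, 0 < E s)
    (h : ∀ s, 0 ≤ s → s * p ≤ Real.log (E s) + C) :
    p - q ≤ 1 - Real.exp (-(2 * (Real.log 2 + C))) := by
  set s := 2 * (Real.log 2 + C) with hs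
  have hl : 0 < Real.log 2 := Real.log_pos (by norm_num)
  have hs0 : 0 < s := by positivity
  -- If `q ≥ exp (-s)`, then `p ≤ 1` is enough. Otherwise `E s ≤ 2`, so `s p ≤ log 2 + C = s/2`,
  -- which forces `p ≤ 1/2`; this is why `s` is twice `log 2 + C`.
  rcases le_total (Real.exp (-s)) q with hq | hq
  · linarith
  · have h1 : E s ≤ 2 := by
      have : (Real.exp s - 1) * q ≤ Real.exp s * Real.exp (-s) := by
        have := Real.exp_pos s
        nlinarith
      rw [← Real.exp_add, add_neg_cancel, Real.exp_zero] at this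
      linarith [hE s hs0.le]
    have h2 := h s hs0.le
    have h3 : Real.log (E s) ≤ Real.log 2 := Real.log_le_log (hEpos s) h1
    have h4 : p ≤ 1 / 2 := by
      have : s * p ≤ s * (1 / 2) := by rw [hs] at h2 ⊢; linarith
      exact le_of_mul_le_mul_left this hs0
    have h5 : Real.exp (-s) ≤ 1 / 2 := by
      rw [show (1 / 2 : ℝ) = Real.exp (-Real.log 2) by
        rw [Real.exp_neg, Real.exp_log (by norm_num)]; norm_num]
      exact Real.exp_le_exp.2 (by rw [hs]; linarith)
    linarith

theorem exp_mul_le_affine {s u : ℝ} (hu : u ∈ Set.Icc (0 : ℝ) 1) :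
    Real.exp (s * u) ≤ 1 + (Real.exp s - 1) * u := by
  have h := convexOn_exp.2 (Set.mem_univ (0 : ℝ)) (Set.mem_univ s)
    (sub_nonneg.2 hu.2) hu.1 (by ring)
  simp only [smul_eq_mul, mul_zero, zero_add, Real.exp_zero, mul_one] at h
  rw [mul_comm s u]
  linarith

/-- Apply the log-Harnack inequality to `s f` for all `s ≥ 0`. Since `f` lies in `[0,1]`, the chord
bound for `exp` makes the exponential moment affine in the evolved `f`. -/
theorem iterate_evolve_overlap (hb : Measurable b) (hδ : 0 < δ) {η h C : ℝ} (hη : 0 ≤ η)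
    (hh : 0 < h) (hstep : ∀ x y, ‖x + δ • b x - (y + δ • b y)‖ ≤ ‖x - y‖ + η)
    (hf : BddMeasurable f) (hf01 : ∀ x, f x ∈ Set.Icc (0 : ℝ) 1) (k : ℕ)
    (hC : k * ((h + η) ^ 2 / (4 * δ)) ≤ C) (x y : Vec d) (hxy : ‖x - y‖ ≤ k * h) :
    (evolve b δ)^[k] f x - (evolve b δ)^[k] f y ≤
      1 - Real.exp (-(2 * (Real.log 2 + C))) := by
  have hC0 : 0 ≤ C := le_trans (by positivity) hC
  refine sub_le_of_le_log (E := fun s => (evolve b δ)^[k] (fun x => Real.exp (s * f x)) y) hC0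
    (iterate_evolve_mem_Icc hb hf hf01 k y).1 (iterate_evolve_mem_Icc hb hf hf01 k x).2 ?_
    (fun s => iterate_evolve_exp_pos hb (hf.const_mul s) k y) ?_
  · intro s _
    have h1 := iterate_evolve_mono (δ := δ) hb (hf.const_mul s).exp
      ((BddMeasurable.const 1).add (hf.const_mul (Real.exp s - 1)))
      (fun x => exp_mul_le_affine (hf01 x)) k y
    rwa [iterate_evolve_add hb (.const 1) (hf.const_mul _), iterate_evolve_const,
      iterate_evolve_const_mul] at h1
  · intro s _
    have h1 := log_harnack hb hδ hη hh hstep (hf.const_mul s) k x y hxy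
    rw [iterate_evolve_const_mul] at h1
    linarith

end evolve

end PnPULA

namespace PnPULA

/-! ### Contraction of the iterated transition operator -/

section contraction

variable {d : ℕ} {b b' : Vec d → Vec d} {δ a B : ℝ} {f : Vec d → ℝ}

/-- One step of synchronous coupling: both chains use the same noise, so an estimate for each fixed
increment is enough. -/
theorem abs_evolve_sub_evolve_le (hf : BddMeasurable f) (x y : Vec d) {D : ℝ}
    (h : ∀ z, |f (x + δ • b x + z) - f (y + δ • b' y + z)| ≤ D) :
    |evolve b δ f x - evolve b' δ f y| ≤ D := by
  rw [evolve, evolve, ← integral_sub (hf.integrable_step x) (hf.integrable_step y)]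
  have h := norm_integral_le_of_norm_le_const (μ := stdGaussian (Vec d)) (C := D)
    (f := fun z => f (x + δ • b x + √(2 * δ) • z) - f (y + δ • b' y + √(2 * δ) • z))
    (ae_of_all _ fun z => by simpa using h _)
  simpa using h

/-- Synchronous coupling of a chain whose drift is contractive up to an additive error. -/
theorem abs_iterate_evolve_sub_le (hb : Measurable b) (ha : 0 < a) (haδ : a * δ ≤ 1)
    (hstep : ∀ x y, ‖x + δ • b x - (y + δ • b y)‖ ≤ (1 - a * δ) * ‖x - y‖ + δ * B)
    (hf : BddMeasurable f) {c : ℝ} (hc : 0 ≤ c) (hlip : ∀ x y, |f x - f y| ≤ c * ‖x - y‖)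
    (k : ℕ) (x y : Vec d) :
    |(evolve b δ)^[k] f x - (evolve b δ)^[k] f y| ≤
      c * ((1 - a * δ) ^ k * ‖x - y‖ + B / a * (1 - (1 - a * δ) ^ k)) := by
  induction k generalizing x y with
  | zero => simpa using hlip x y
  | succ k ih =>
    simp_rw [Function.iterate_succ_apply']
    refine abs_evolve_sub_evolve_le (hf.iterate_evolve hb k) x y fun z => (ih _ _).trans ?_
    rw [add_sub_add_right_eq_sub]
    have hq : 0 ≤ (1 - a * δ) ^ k := pow_nonneg (by linarith) k
    refine mul_le_mul_of_nonneg_left ?_ hc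
    have h1 := mul_le_mul_of_nonneg_left (hstep x y) hq
    have h2 : (1 - a * δ) ^ k * ((1 - a * δ) * ‖x - y‖ + δ * B) + B / a * (1 - (1 - a * δ) ^ k) =
        (1 - a * δ) ^ (k + 1) * ‖x - y‖ + B / a * (1 - (1 - a * δ) ^ (k + 1)) := by
      field_simp
      ring
    linarith

/-- Sums of a bounded `β`-Lipschitz function and a measurable function with values in `[0, 1]`. -/
def LipschitzPlusUnit (β : ℝ) (φ : Vec d → ℝ) : Prop :=
  ∃ ψ g : Vec d → ℝ, BddMeasurable ψ ∧ BddMeasurable g ∧ (∀ x y, |ψ x - ψ y| ≤ β * ‖x - y‖) ∧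
    (∀ x, g x ∈ Set.Icc (0 : ℝ) 1) ∧ φ = fun x => ψ x + g x

theorem LipschitzPlusUnit.bddMeasurable {β : ℝ} (hf : LipschitzPlusUnit β f) :
    BddMeasurable f := by
  obtain ⟨ψ, g, hψ, hg, -, -, rfl⟩ := hf
  exact hψ.add hg

theorem LipschitzPlusUnit.of_mem_Icc {β : ℝ} (hβ : 0 ≤ β) (hf : BddMeasurable f)
    (h : ∀ x, f x ∈ Set.Icc (0 : ℝ) 1) : LipschitzPlusUnit β f :=
  ⟨fun _ => 0, f, .const 0, hf, fun x y => by simpa using by positivity, h, by simp⟩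

/-- A bounded function of oscillation at most `1 + β ‖x - y‖` splits, by inf-convolution. -/
theorem LipschitzPlusUnit.of_abs_sub_le {β : ℝ} (hβ : 0 ≤ β) (hf : BddMeasurable f)
    (h : ∀ x y, |f x - f y| ≤ 1 + β * ‖x - y‖) : LipschitzPlusUnit β f := by
  obtain ⟨C, hC⟩ := hf.bounded
  -- The largest `β`-Lipschitz minorant of `f`. The oscillation bound is precisely what gives `f - 1
  -- ≤ ψ`, so `f - ψ` takes values in `[0,1]`.
  set ψ : Vec d → ℝ := fun x => ⨅ y, (f y + β * ‖x - y‖) with hψ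
  have hbdd : ∀ x, BddBelow (Set.range fun y => f y + β * ‖x - y‖) := by
    refine fun x => ⟨-C, ?_⟩
    rintro _ ⟨y, rfl⟩
    have : 0 ≤ β * ‖x - y‖ := by positivity
    have := (abs_le.1 (hC y)).1
    simp only
    linarith
  have hle : ∀ x, ψ x ≤ f x := fun x => by simpa using ciInf_le (hbdd x) x
  have hge : ∀ x, f x - 1 ≤ ψ x := fun x => le_ciInf fun y => by
    have := (abs_le.1 (h x y)).2
    linarith
  have hlip1 : ∀ x y, ψ x - ψ y ≤ β * ‖x - y‖ := by
    intro x y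
    rw [sub_le_comm]
    refine le_ciInf fun z => ?_
    have h1 : ψ x ≤ f z + β * ‖x - z‖ := ciInf_le (hbdd x) z
    have h2 : β * ‖x - z‖ ≤ β * (‖x - y‖ + ‖y - z‖) :=
      mul_le_mul_of_nonneg_left (norm_sub_le_norm_sub_add_norm_sub x y z) hβ
    linarith
  have hlip : ∀ x y, |ψ x - ψ y| ≤ β * ‖x - y‖ := fun x y => by
    rw [abs_le]
    have := hlip1 y x
    rw [norm_sub_rev] at this
    exact ⟨by linarith, hlip1 x y⟩
  have hψm : Measurable ψ := by
    have : LipschitzWith (Real.toNNReal β) ψ := LipschitzWith.of_dist_le_mul fun x y => by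
      rw [Real.dist_eq, dist_eq_norm, Real.coe_toNNReal _ hβ]
      exact hlip x y
    exact this.continuous.measurable
  have hψb : BddMeasurable ψ := ⟨hψm, C + 1, fun x => by
    have h1 := abs_le.1 (hC x)
    have h2 := hle x
    have h3 := hge x
    rw [abs_le]
    constructor <;> linarith⟩
  refine ⟨ψ, fun x => f x - ψ x, hψb, hf.sub hψb, hlip,
    fun x => ⟨by linarith [hle x], by linarith [hge x]⟩, by ext; ring⟩

/-- The number of steps after which the chain contracts. -/
noncomputable def blockLength (a δ : ℝ) : ℕ := ⌈1 / (a * δ)⌉₊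

theorem one_div_le_blockLength_mul (hδ : 0 < δ) :
    1 / a ≤ blockLength a δ * δ := by
  have h := Nat.le_ceil (1 / (a * δ))
  have h2 := mul_le_mul_of_nonneg_right h hδ.le
  have h3 : 1 / (a * δ) * δ = 1 / a := by field_simp
  exact h3.ge.trans h2

theorem blockLength_mul_le (ha : 0 < a) (hδ : 0 < δ) (haδ : a * δ ≤ 1) :
    blockLength a δ * δ ≤ 2 / a := by
  have h := Nat.ceil_lt_add_one (a := 1 / (a * δ)) (by positivity)
  have h2 := mul_le_mul_of_nonneg_right h.le hδ.le
  have h3 : (1 / (a * δ) + 1) * δ = 1 / a + δ := by field_simp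
  have h4 : δ ≤ 1 / a := by rw [le_div_iff₀ ha]; linarith
  have h5 : 2 / a = 1 / a + 1 / a := by ring
  unfold blockLength
  linarith

theorem one_sub_pow_blockLength_le (ha : 0 < a) (hδ : 0 < δ) (haδ : a * δ ≤ 1) :
    (1 - a * δ) ^ blockLength a δ ≤ 1 / 2 := by
  have h1 : (1 - a * δ) ^ blockLength a δ ≤ Real.exp (-(a * δ)) ^ blockLength a δ :=
    pow_le_pow_left₀ (by linarith) (by linarith [Real.add_one_le_exp (-(a * δ))]) _
  rw [← Real.exp_nat_mul] at h1
  have h2 : (1 : ℝ) ≤ a * (blockLength a δ * δ) := by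
    have := mul_le_mul_of_nonneg_left (one_div_le_blockLength_mul (a := a) hδ) ha.le
    rwa [mul_one_div_cancel ha.ne'] at this
  have h3 : Real.exp (blockLength a δ * -(a * δ)) ≤ Real.exp (-1) :=
    Real.exp_le_exp.2 (by linarith)
  have h4 : Real.exp (-1) ≤ 1 / 2 := by
    rw [Real.exp_neg, one_div]
    exact inv_anti₀ (by norm_num) (by linarith [Real.add_one_le_exp (1 : ℝ)])
  linarith

/-- The overlap of the laws of two chains after one block, started at distance at most
`4 B / a + 4`. -/
noncomputable def overlap (a B : ℝ) : ℝ :=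
  Real.exp (-(2 * (Real.log 2 + (4 * (B / a) + 4 + 2 * (B / a)) ^ 2 * a / 4)))

/-- The Lipschitz weight for which blocks are contractive. -/
noncomputable def lipWeight (a B : ℝ) : ℝ := overlap a B / (2 * (B / a + 1))

theorem overlap_pos : 0 < overlap a B := Real.exp_pos _

theorem overlap_le (ha : 0 < a) : overlap a B ≤ 1 / 4 := by
  have h : (1 / 4 : ℝ) = Real.exp (-(2 * Real.log 2)) := by
    rw [Real.exp_neg, mul_comm, Real.exp_mul, Real.exp_log (by norm_num)]; norm_num
  rw [h]
  refine Real.exp_le_exp.2 ?_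
  have : 0 ≤ (4 * (B / a) + 4 + 2 * (B / a)) ^ 2 * a / 4 := by positivity
  linarith

theorem lipWeight_pos (ha : 0 < a) (hB : 0 ≤ B) : 0 < lipWeight a B := by
  have := overlap_pos (a := a) (B := B)
  unfold lipWeight
  positivity

theorem lipWeight_mul (ha : 0 < a) (hB : 0 ≤ B) :
    lipWeight a B * (B / a) + lipWeight a B = overlap a B / 2 := by
  have : 0 < B / a + 1 := by positivity
  rw [lipWeight]
  field_simp

theorem lipWeight_le (ha : 0 < a) (hB : 0 ≤ B) : lipWeight a B ≤ 1 / 8 := by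
  have h1 := lipWeight_mul ha hB
  have h2 := overlap_le (B := B) ha
  have h3 : 0 ≤ lipWeight a B * (B / a) :=
    mul_nonneg (lipWeight_pos ha hB).le (by positivity)
  linarith

theorem iterate_evolve_overlap_blockLength (hb : Measurable b) (ha : 0 < a) (hB : 0 ≤ B)
    (hδ : 0 < δ) (haδ : a * δ ≤ 1)
    (hstep : ∀ x y, ‖x + δ • b x - (y + δ • b y)‖ ≤ (1 - a * δ) * ‖x - y‖ + δ * B)
    (hf : BddMeasurable f) (hf01 : ∀ x, f x ∈ Set.Icc (0 : ℝ) 1) (x y : Vec d)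
    (hxy : ‖x - y‖ ≤ 4 * (B / a) + 4) :
    (evolve b δ)^[blockLength a δ] f x - (evolve b δ)^[blockLength a δ] f y ≤ 1 - overlap a B := by
  have hN := one_div_le_blockLength_mul (a := a) hδ
  have hN' := blockLength_mul_le ha hδ haδ
  set N := blockLength a δ with hNdef
  have hNδ : 0 < N * δ := lt_of_lt_of_le (by positivity) hN
  have hN0 : (0 : ℝ) < N := pos_of_mul_pos_left hNδ hδ.le
  set R := 4 * (B / a) + 4 with hR
  have hR0 : 0 < R := by positivity
  -- Spread the distance `R` evenly over the `N` steps. The total cost `(R + NδB)²/(4Nδ)` is bounded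
  -- uniformly in `δ` because `1/a ≤ Nδ ≤ 2/a`.
  refine iterate_evolve_overlap hb hδ (η := δ * B) (h := R / N) (by positivity) (by positivity)
    (fun x y => (hstep x y).trans ?_) hf hf01 N ?_ x y ?_
  · have : 0 ≤ a * δ * ‖x - y‖ := by positivity
    linarith
  · have e : N * ((R / N + δ * B) ^ 2 / (4 * δ)) = (R + N * δ * B) ^ 2 / (4 * (N * δ)) := by
      field_simp
    rw [e, div_le_iff₀ (by positivity)]
    have h1 : (R + N * δ * B) ^ 2 ≤ (R + 2 * (B / a)) ^ 2 := by
      have : N * δ * B ≤ 2 / a * B := mul_le_mul_of_nonneg_right hN' hB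
      have e2 : 2 / a * B = 2 * (B / a) := by ring
      refine pow_le_pow_left₀ (by positivity) (by linarith) 2
    have h2 : 1 ≤ a * (N * δ) := by
      have := mul_le_mul_of_nonneg_left hN ha.le
      rwa [mul_one_div_cancel ha.ne'] at this
    calc (R + N * δ * B) ^ 2 ≤ (R + 2 * (B / a)) ^ 2 * 1 := by rw [mul_one]; exact h1
      _ ≤ (R + 2 * (B / a)) ^ 2 * (a * (N * δ)) := by gcongr
      _ = _ := by ring
  · rw [mul_div_cancel₀ _ hN0.ne']
    exact hxy

/-- One block contracts the oscillation relative to `1 + β ‖x - y‖`. -/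
theorem abs_block_sub_le (hb : Measurable b) (ha : 0 < a) (hB : 0 ≤ B)
    (hδ : 0 < δ) (haδ : a * δ ≤ 1)
    (hstep : ∀ x y, ‖x + δ • b x - (y + δ • b y)‖ ≤ (1 - a * δ) * ‖x - y‖ + δ * B)
    (hf : LipschitzPlusUnit (lipWeight a B) f) (x y : Vec d) :
    |(evolve b δ)^[blockLength a δ] f x - (evolve b δ)^[blockLength a δ] f y| ≤
      (1 - lipWeight a B) * (1 + lipWeight a B * ‖x - y‖) := by
  obtain ⟨ψ, g, hψ, hg, hlip, hg01, rfl⟩ := hf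
  have hβ := lipWeight_pos ha hB
  have hβ8 := lipWeight_le ha hB
  have hβm := lipWeight_mul ha hB
  have hη := overlap_pos (a := a) (B := B)
  set β := lipWeight a B
  set N := blockLength a δ
  have h1 : |(evolve b δ)^[N] ψ x - (evolve b δ)^[N] ψ y| ≤ β * (‖x - y‖ / 2 + B / a) := by
    refine (abs_iterate_evolve_sub_le hb ha haδ hstep hψ hβ.le hlip N x y).trans
      (mul_le_mul_of_nonneg_left ?_ hβ.le)
    have h2 : (1 - a * δ) ^ N ≤ 1 / 2 := one_sub_pow_blockLength_le ha hδ haδ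
    have h3 : 0 ≤ (1 - a * δ) ^ N := pow_nonneg (by linarith) _
    have h4 : (1 - a * δ) ^ N * ‖x - y‖ ≤ 1 / 2 * ‖x - y‖ := by gcongr
    have h5 : B / a * (1 - (1 - a * δ) ^ N) ≤ B / a :=
      mul_le_of_le_one_right (by positivity) (by linarith)
    linarith
  rw [iterate_evolve_add hb hψ hg]
  have htri : |(evolve b δ)^[N] ψ x + (evolve b δ)^[N] g x -
      ((evolve b δ)^[N] ψ y + (evolve b δ)^[N] g y)| ≤
      |(evolve b δ)^[N] ψ x - (evolve b δ)^[N] ψ y| +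
        |(evolve b δ)^[N] g x - (evolve b δ)^[N] g y| := by
    rw [add_sub_add_comm]
    exact abs_add_le _ _
  have hr : 0 ≤ β * ‖x - y‖ := by positivity
  have hβ2 : 0 ≤ (1 / 2 - β) * (β * ‖x - y‖) := mul_nonneg (by linarith) hr
  have hC0 : 0 ≤ β * (B / a) := by positivity
  -- At moderate distance the overlap gains on the unit part; half of it absorbs `β B/a + β`, by the
  -- choice of `β`. At large distance the unit part gains nothing, but the halving of `‖x - y‖`
  -- saves enough: a quarter of `β‖x - y‖` already exceeds `β B/a + β`.
  rcases le_total ‖x - y‖ (4 * (B / a) + 4) with hxy | hxy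
  · have h2 : |(evolve b δ)^[N] g x - (evolve b δ)^[N] g y| ≤ 1 - overlap a B := by
      have e1 := iterate_evolve_overlap_blockLength hb ha hB hδ haδ hstep hg hg01 x y hxy
      have e2 := iterate_evolve_overlap_blockLength hb ha hB hδ haδ hstep hg hg01 y x
        (by rwa [norm_sub_rev])
      rw [abs_le]
      exact ⟨by linarith, e1⟩
    nlinarith
  · have h2 : |(evolve b δ)^[N] g x - (evolve b δ)^[N] g y| ≤ 1 := by
      have e1 := iterate_evolve_mem_Icc (δ := δ) hb hg hg01 N x
      have e2 := iterate_evolve_mem_Icc (δ := δ) hb hg hg01 N y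
      rw [abs_le]
      exact ⟨by linarith [e1.1, e2.2], by linarith [e1.2, e2.1]⟩
    have h3 := mul_le_mul_of_nonneg_left hxy hβ.le
    have hβ3 : 0 ≤ (1 / 8 - β) * (β * ‖x - y‖) := mul_nonneg (by linarith) hr
    nlinarith

/-- The contracted oscillation bound, rescaled, can be split again by inf-convolution. The class is
therefore stable and the block estimate can be iterated. -/
theorem LipschitzPlusUnit.block (hb : Measurable b) (ha : 0 < a) (hB : 0 ≤ B)
    (hδ : 0 < δ) (haδ : a * δ ≤ 1)
    (hstep : ∀ x y, ‖x + δ • b x - (y + δ • b y)‖ ≤ (1 - a * δ) * ‖x - y‖ + δ * B)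
    (hf : LipschitzPlusUnit (lipWeight a B) f) :
    LipschitzPlusUnit (lipWeight a B)
      fun x => (1 - lipWeight a B)⁻¹ * (evolve b δ)^[blockLength a δ] f x := by
  have hβ := lipWeight_pos ha hB
  have hβ8 := lipWeight_le ha hB
  have hα : 0 < 1 - lipWeight a B := by linarith
  refine .of_abs_sub_le hβ.le ((hf.bddMeasurable.iterate_evolve hb _).const_mul _) fun x y => ?_
  rw [← mul_sub, abs_mul, abs_of_pos (inv_pos.2 hα), inv_mul_le_iff₀ hα]
  exact abs_block_sub_le hb ha hB hδ haδ hstep hf x y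

/-- After `j` blocks, oscillations have decreased geometrically. -/
theorem LipschitzPlusUnit.blocks (hb : Measurable b) (ha : 0 < a) (hB : 0 ≤ B)
    (hδ : 0 < δ) (haδ : a * δ ≤ 1)
    (hstep : ∀ x y, ‖x + δ • b x - (y + δ • b y)‖ ≤ (1 - a * δ) * ‖x - y‖ + δ * B)
    (hf : LipschitzPlusUnit (lipWeight a B) f) (j : ℕ) :
    ∃ h, LipschitzPlusUnit (lipWeight a B) h ∧
      (evolve b δ)^[j * blockLength a δ] f = fun x => (1 - lipWeight a B) ^ j * h x := by
  have hα : 1 - lipWeight a B ≠ 0 := by linarith [lipWeight_le ha hB]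
  induction j with
  | zero => exact ⟨f, hf, by simp⟩
  | succ j ih =>
    obtain ⟨h, hh, heq⟩ := ih
    refine ⟨_, hh.block hb ha hB hδ haδ hstep, ?_⟩
    rw [add_mul, one_mul, add_comm, Function.iterate_add_apply, heq, iterate_evolve_const_mul]
    ext x
    rw [pow_succ]
    field_simp

theorem LipschitzPlusUnit.abs_sub_le {β : ℝ} (hf : LipschitzPlusUnit β f) (x y : Vec d) :
    |f x - f y| ≤ 1 + β * ‖x - y‖ := by
  obtain ⟨ψ, g, -, -, hlip, hg01, rfl⟩ := hf
  have h1 := abs_le.1 (hlip x y)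
  have h2 := hg01 x
  have h3 := hg01 y
  rw [abs_le]
  exact ⟨by linarith [h2.1, h3.2, h1.1], by linarith [h2.2, h3.1, h1.2]⟩

end contraction

end PnPULA

namespace PnPULA

/-! ### Invariant laws: moments, existence and uniqueness -/

open Filter Topology

/-- The drift `b` makes one step of size `δ` contractive with rate `a`, up to an additive error
`δ B`. -/
structure ContractiveDrift {d : ℕ} (b : Vec d → Vec d) (δ a B : ℝ) : Prop where
  continuous : Continuous b
  rate_pos : 0 < a
  error_nonneg : 0 ≤ B
  step_pos : 0 < δ
  rate_mul_step_le : a * δ ≤ 1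
  step : ∀ x y, ‖x + δ • b x - (y + δ • b y)‖ ≤ (1 - a * δ) * ‖x - y‖ + δ * B

section invariant

variable {d : ℕ} {b : Vec d → Vec d} {δ a B K : ℝ} {f : Vec d → ℝ}

theorem integrable_norm_sq_stdGaussian (d : ℕ) :
    Integrable (fun z : Vec d => ‖z‖ ^ 2) (stdGaussian (Vec d)) :=
  (IsGaussian.memLp_two_id (μ := stdGaussian (Vec d))).integrable_norm_pow (by norm_num)

theorem integrable_inner_stdGaussian (v : Vec d) :
    Integrable (fun z => inner ℝ v z) (stdGaussian (Vec d)) :=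
  (innerSL ℝ v).integrable_comp IsGaussian.integrable_id

theorem norm_add_smul_sq (u z : Vec d) (s : ℝ) :
    ‖u + s • z‖ ^ 2 = ‖u‖ ^ 2 + 2 * s * inner ℝ u z + s ^ 2 * ‖z‖ ^ 2 := by
  rw [norm_add_sq_real, real_inner_smul_right, norm_smul, mul_pow, Real.norm_eq_abs, sq_abs]
  ring

theorem integrable_norm_step_sq (u : Vec d) (s : ℝ) :
    Integrable (fun z => ‖u + s • z‖ ^ 2) (stdGaussian (Vec d)) := by
  simp_rw [norm_add_smul_sq]
  exact ((integrable_const _).add ((integrable_inner_stdGaussian u).const_mul _)).add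
    ((integrable_norm_sq_stdGaussian d).const_mul _)

theorem integral_norm_step_sq (u : Vec d) (s : ℝ) :
    ∫ z, ‖u + s • z‖ ^ 2 ∂(stdGaussian (Vec d)) =
      ‖u‖ ^ 2 + s ^ 2 * ∫ z, ‖z‖ ^ 2 ∂(stdGaussian (Vec d)) := by
  have h1 := integral_add ((integrable_const (‖u‖ ^ 2)).add
    ((integrable_inner_stdGaussian u).const_mul (2 * s)))
    ((integrable_norm_sq_stdGaussian d).const_mul (s ^ 2))
  have h2 := integral_add (integrable_const (μ := stdGaussian (Vec d)) (‖u‖ ^ 2))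
    ((integrable_inner_stdGaussian u).const_mul (2 * s))
  have h0 : ∫ z, inner ℝ u z ∂(stdGaussian (Vec d)) = 0 :=
    integral_strongDual_stdGaussian (innerSL ℝ u)
  simp only [Pi.add_apply] at h1
  simp only [integral_const, probReal_univ, one_smul, integral_const_mul, h0, mul_zero,
    add_zero] at h1 h2
  simp_rw [norm_add_smul_sq]
  rw [h1, h2]

/-- A bound for the stationary second moment. -/
noncomputable def momentBound (d : ℕ) (a B K : ℝ) : ℝ :=
  ((B + K) ^ 2 / a + 2 * ∫ z, ‖z‖ ^ 2 ∂(stdGaussian (Vec d))) / a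

theorem momentBound_nonneg (ha : 0 < a) : 0 ≤ momentBound d a B K := by
  have : 0 ≤ ∫ z, ‖z‖ ^ 2 ∂(stdGaussian (Vec d)) := integral_nonneg fun z => by positivity
  unfold momentBound
  positivity

namespace ContractiveDrift

theorem norm_step_le (h : ContractiveDrift b δ a B) (hK : ‖b 0‖ ≤ K) (x : Vec d) :
    ‖x + δ • b x‖ ≤ (1 - a * δ) * ‖x‖ + δ * (B + K) := by
  have h1 := h.step x 0
  rw [zero_add, sub_zero] at h1
  have h2 : ‖δ • b 0‖ ≤ δ * K := by
    rw [norm_smul, Real.norm_of_nonneg h.step_pos.le]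
    exact mul_le_mul_of_nonneg_left hK h.step_pos.le
  have h3 := norm_sub_norm_le (x + δ • b x) (δ • b 0)
  linarith

theorem norm_step_sq_le (h : ContractiveDrift b δ a B) (hK : ‖b 0‖ ≤ K) (x : Vec d) :
    ‖x + δ • b x‖ ^ 2 ≤ (1 - a * δ) * ‖x‖ ^ 2 + δ * ((B + K) ^ 2 / a) := by
  have h1 := h.norm_step_le hK x
  have ha := h.rate_pos
  have hδ := h.step_pos
  have h2 : ‖x + δ • b x‖ ^ 2 ≤ ((1 - a * δ) * ‖x‖ + δ * (B + K)) ^ 2 := by gcongr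
  -- Convexity of the square with weights `1 - aδ` and `aδ` at the points `‖x‖` and `(B + K)/a`,
  -- with its exact defect.
  have h3 : (1 - a * δ) * ‖x‖ ^ 2 + δ * ((B + K) ^ 2 / a) -
      ((1 - a * δ) * ‖x‖ + δ * (B + K)) ^ 2 =
      (1 - a * δ) * (a * δ) * (‖x‖ - (B + K) / a) ^ 2 := by
    field_simp
    ring
  have h4 : 0 ≤ (1 - a * δ) * (a * δ) * (‖x‖ - (B + K) / a) ^ 2 :=
    mul_nonneg (mul_nonneg (by linarith [h.rate_mul_step_le]) (by positivity)) (sq_nonneg _)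
  linarith

theorem integral_norm_step_sq_le (h : ContractiveDrift b δ a B) (hK : ‖b 0‖ ≤ K) (x : Vec d) :
    ∫ z, ‖x + δ • b x + √(2 * δ) • z‖ ^ 2 ∂(stdGaussian (Vec d)) ≤
      (1 - a * δ) * ‖x‖ ^ 2 + a * δ * momentBound d a B K := by
  have ha := h.rate_pos
  rw [integral_norm_step_sq, Real.sq_sqrt (by linarith [h.step_pos])]
  have h1 := h.norm_step_sq_le hK x
  have h2 : a * δ * momentBound d a B K = δ * ((B + K) ^ 2 / a) +
      2 * δ * ∫ z, ‖z‖ ^ 2 ∂(stdGaussian (Vec d)) := by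
    unfold momentBound
    field_simp
  linarith

end ContractiveDrift

theorem bddMeasurable_min_norm_sq {n : ℝ} (hn : 0 ≤ n) :
    BddMeasurable fun x : Vec d => min (‖x‖ ^ 2) n := by
  refine ⟨by fun_prop, n, fun x => ?_⟩
  rw [abs_of_nonneg (by positivity)]
  exact min_le_right _ _

namespace ContractiveDrift

/-- The Lyapunov inequality for `‖x‖²`, iterated. Truncation keeps the test function bounded, and
the bound does not depend on the level `n`. -/
theorem iterate_min_norm_sq_le (h : ContractiveDrift b δ a B) (hK : ‖b 0‖ ≤ K) {n : ℝ}
    (hn : 0 ≤ n) (k : ℕ) (x : Vec d) :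
    (evolve b δ)^[k] (fun x => min (‖x‖ ^ 2) n) x ≤
      (1 - a * δ) ^ k * ‖x‖ ^ 2 + (1 - (1 - a * δ) ^ k) * momentBound d a B K := by
  induction k generalizing x with
  | zero => simp
  | succ k ih =>
    rw [Function.iterate_succ_apply']
    have hq : 0 ≤ (1 - a * δ) ^ k := pow_nonneg (by linarith [h.rate_mul_step_le]) k
    have hint := integrable_norm_step_sq (x + δ • b x) (√(2 * δ))
    have h1 : evolve b δ ((evolve b δ)^[k] fun x => min (‖x‖ ^ 2) n) x ≤
        ∫ z, ((1 - a * δ) ^ k * ‖x + δ • b x + √(2 * δ) • z‖ ^ 2 +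
          (1 - (1 - a * δ) ^ k) * momentBound d a B K) ∂(stdGaussian (Vec d)) :=
      integral_mono (((bddMeasurable_min_norm_sq hn).iterate_evolve
        h.continuous.measurable k).integrable_step x)
        ((hint.const_mul _).add (integrable_const _)) fun z => ih _
    rw [integral_add (hint.const_mul _) (integrable_const _), integral_const_mul] at h1
    simp only [integral_const, probReal_univ, one_smul] at h1
    have h2 := mul_le_mul_of_nonneg_left (h.integral_norm_step_sq_le hK x) hq
    rw [pow_succ]
    linarith

theorem one_sub_pow_mul_momentBound_le (h : ContractiveDrift b δ a B) (k : ℕ) :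
    (1 - (1 - a * δ) ^ k) * momentBound d a B K ≤ momentBound d a B K :=
  mul_le_of_le_one_left (momentBound_nonneg h.rate_pos)
    (by linarith [pow_nonneg (by linarith [h.rate_mul_step_le] : 0 ≤ 1 - a * δ) k])

end ContractiveDrift

/-! #### Invariance as an identity of integrals -/

theorem transition_eq (x : Vec d) {A : Set (Vec d)} (hA : MeasurableSet A) :
    transition b δ x A = stdGaussian (Vec d) (Prod.mk x ⁻¹' (chainStep b δ ⁻¹' A)) := by
  rw [transition, Measure.map_apply (measurable_step_right x) hA]
  rfl

theorem map_chainStep_apply (hb : Measurable b) (π : Measure (Vec d)) {A : Set (Vec d)}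
    (hA : MeasurableSet A) :
    (π.prod (stdGaussian (Vec d))).map (chainStep b δ) A = ∫⁻ x, transition b δ x A ∂π := by
  rw [Measure.map_apply (measurable_chainStep hb) hA,
    Measure.prod_apply (measurable_chainStep hb hA)]
  simp_rw [transition_eq _ hA]

theorem integral_map_chainStep (hb : Measurable b) (π : Measure (Vec d)) [IsFiniteMeasure π]
    (hf : BddMeasurable f) :
    ∫ x, f x ∂((π.prod (stdGaussian (Vec d))).map (chainStep b δ)) = ∫ x, evolve b δ f x ∂π := by
  have hm := measurable_chainStep (δ := δ) hb
  rw [integral_map hm.aemeasurable hf.measurable.aestronglyMeasurable, integral_prod]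
  · rfl
  · obtain ⟨C, hC⟩ := hf.bounded
    exact Integrable.of_bound (hf.measurable.comp hm).aestronglyMeasurable C
      (ae_of_all _ fun x => by simpa using hC _)

theorem IsInvariantLaw.map_chainStep (hb : Measurable b) {π : Measure (Vec d)}
    (h : IsInvariantLaw b δ π) : (π.prod (stdGaussian (Vec d))).map (chainStep b δ) = π :=
  Measure.ext fun A hA => by rw [map_chainStep_apply hb π hA, h.2 A hA]

theorem IsInvariantLaw.integral_evolve (hb : Measurable b) {π : Measure (Vec d)}
    (h : IsInvariantLaw b δ π) (hf : BddMeasurable f) :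
    ∫ x, evolve b δ f x ∂π = ∫ x, f x ∂π := by
  have := h.1
  rw [← integral_map_chainStep hb π hf, h.map_chainStep hb]

theorem IsInvariantLaw.integral_iterate_evolve (hb : Measurable b) {π : Measure (Vec d)}
    (h : IsInvariantLaw b δ π) (hf : BddMeasurable f) (k : ℕ) :
    ∫ x, (evolve b δ)^[k] f x ∂π = ∫ x, f x ∂π := by
  induction k with
  | zero => rfl
  | succ k ih =>
    simp_rw [Function.iterate_succ_apply']
    rw [h.integral_evolve hb (hf.iterate_evolve hb k), ih]

/-- Stationary second moments are bounded uniformly in the step size. -/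
theorem IsInvariantLaw.lintegral_norm_sq_le {π : Measure (Vec d)} (hπ : IsInvariantLaw b δ π)
    (h : ContractiveDrift b δ a B) (hK : ‖b 0‖ ≤ K) :
    ∫⁻ x, ‖x‖ₑ ^ 2 ∂π ≤ ENNReal.ofReal (momentBound d a B K) := by
  have := hπ.1
  have hb := h.continuous.measurable
  set Q := momentBound d a B K
  have hQ : 0 ≤ Q := momentBound_nonneg h.rate_pos
  have hq0 : 0 ≤ 1 - a * δ := by linarith [h.rate_mul_step_le]
  have hq1 : 1 - a * δ < 1 := by linarith [mul_pos h.rate_pos h.step_pos]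
  have hn : ∀ n : ℕ, ∫ x, min (‖x‖ ^ 2) (n : ℝ) ∂π ≤ Q := by
    intro n
    have hV := bddMeasurable_min_norm_sq (d := d) (n := n) (by positivity)
    -- Nothing is known a priori about the second moment of `π`. Keeping the truncation outside
    -- gives a dominated limit as `k → ∞`, which removes the dependence on `‖x‖²`; only afterwards
    -- does `n → ∞`.
    have hk : ∀ k : ℕ, ∫ x, min (‖x‖ ^ 2) (n : ℝ) ∂π ≤
        ∫ x, min ((1 - a * δ) ^ k * ‖x‖ ^ 2 + Q) (n : ℝ) ∂π := by
      intro k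
      rw [← hπ.integral_iterate_evolve hb hV k]
      refine integral_mono ((hV.iterate_evolve hb k).integrable π) ?_ fun x => le_min ?_ ?_
      · refine Integrable.of_bound (C := n) (by fun_prop) (ae_of_all _ fun x => ?_)
        rw [Real.norm_of_nonneg (by positivity)]
        exact min_le_right _ _
      · exact (h.iterate_min_norm_sq_le hK (by positivity) k x).trans
          (by linarith [h.one_sub_pow_mul_momentBound_le (d := d) (K := K) k])
      · exact (iterate_evolve_mem_Icc hb hV
          (fun x => ⟨by positivity, min_le_right _ _⟩ : ∀ x : Vec d, _ ∈ Set.Icc (0 : ℝ) n) k x).2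
    have hlim : Tendsto (fun k : ℕ => ∫ x, min ((1 - a * δ) ^ k * ‖x‖ ^ 2 + Q) (n : ℝ) ∂π) atTop
        (𝓝 (∫ _, min Q (n : ℝ) ∂π)) := by
      refine tendsto_integral_of_dominated_convergence (fun _ => (n : ℝ)) (fun k => by fun_prop)
        (integrable_const _) (fun k => ae_of_all _ fun x => ?_) (ae_of_all _ fun x => ?_)
      · rw [Real.norm_of_nonneg (by positivity)]
        exact min_le_right _ _
      · have h0 := ((tendsto_pow_atTop_nhds_zero_of_lt_one hq0 hq1).mul_const (‖x‖ ^ 2)).add_const Q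
        rw [zero_mul, zero_add] at h0
        exact h0.min tendsto_const_nhds
    have := ge_of_tendsto' hlim hk
    simp only [integral_const, probReal_univ, one_smul] at this
    exact this.trans (min_le_left _ _)
  have hmono : Tendsto (fun n : ℕ => ∫⁻ x, ENNReal.ofReal (min (‖x‖ ^ 2) (n : ℝ)) ∂π) atTop
      (𝓝 (∫⁻ x, ‖x‖ₑ ^ 2 ∂π)) := by
    refine lintegral_tendsto_of_tendsto_of_monotone (fun n => by fun_prop)
      (ae_of_all _ fun x n n' hnn => ?_) (ae_of_all _ fun x => ?_)
    · exact ENNReal.ofReal_le_ofReal (min_le_min_left _ (by exact_mod_cast hnn))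
    · refine tendsto_const_nhds.congr' ?_
      filter_upwards [eventually_ge_atTop ⌈‖x‖ ^ 2⌉₊] with n hn
      rw [min_eq_left (Nat.ceil_le.1 hn), ENNReal.ofReal_pow (norm_nonneg _), ofReal_norm]
  refine le_of_tendsto' hmono fun n => ?_
  have hV := bddMeasurable_min_norm_sq (d := d) (n := n) (by positivity)
  rw [← ofReal_integral_eq_lintegral_ofReal (hV.integrable π)
    (ae_of_all _ fun x => by positivity)]
  exact ENNReal.ofReal_le_ofReal (hn n)

theorem IsInvariantLaw.integrable_norm_sq {π : Measure (Vec d)} (hπ : IsInvariantLaw b δ π)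
    (h : ContractiveDrift b δ a B) : Integrable (fun x => ‖x‖ ^ 2) π := by
  refine ⟨by fun_prop, ?_⟩
  have h1 := hπ.lintegral_norm_sq_le h le_rfl
  rw [HasFiniteIntegral]
  refine lt_of_le_of_lt ?_ (h1.trans_lt ENNReal.ofReal_lt_top)
  exact lintegral_mono fun x => by simp

/-! #### Ergodicity -/

theorem BddMeasurable.exists_abs_iterate_blocks_sub_le (hf : BddMeasurable f)
    (h : ContractiveDrift b δ a B) : ∃ c, 0 ≤ c ∧ ∀ (j : ℕ) (x y : Vec d),
      |(PnPULA.evolve b δ)^[j * blockLength a δ] f x -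
        (PnPULA.evolve b δ)^[j * blockLength a δ] f y| ≤
        c * (1 - lipWeight a B) ^ j * (1 + lipWeight a B * ‖x - y‖) := by
  obtain ⟨C, hC⟩ := hf.bounded
  have hβ := lipWeight_pos h.rate_pos h.error_nonneg
  have hβ8 := lipWeight_le h.rate_pos h.error_nonneg
  have hC0 : 0 ≤ C := (abs_nonneg _).trans (hC 0)
  have hb := h.continuous.measurable
  -- An affine rescaling into `[0,1]`; the extra `1` covers the case `C = 0`.
  have hg : BddMeasurable fun x => (2 * C + 1)⁻¹ * (f x + C) := (hf.add (.const C)).const_mul _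
  have hg01 : ∀ x, (2 * C + 1)⁻¹ * (f x + C) ∈ Set.Icc (0 : ℝ) 1 := by
    intro x
    have := abs_le.1 (hC x)
    constructor
    · exact mul_nonneg (by positivity) (by linarith)
    · rw [inv_mul_le_iff₀ (by positivity)]
      linarith
  have hclass := LipschitzPlusUnit.of_mem_Icc hβ.le hg hg01
  refine ⟨2 * C + 1, by positivity, fun j x y => ?_⟩
  obtain ⟨g, hgc, hgeq⟩ :=
    hclass.blocks hb h.rate_pos h.error_nonneg h.step_pos h.rate_mul_step_le h.step j
  rw [iterate_evolve_const_mul, iterate_evolve_add hb hf (.const C), iterate_evolve_const] at hgeq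
  have e : ∀ x, (PnPULA.evolve b δ)^[j * blockLength a δ] f x =
      (2 * C + 1) * ((1 - lipWeight a B) ^ j * g x) - C := by
    intro x
    have := congrFun hgeq x
    simp only at this
    rw [← this]
    field_simp
    ring
  have hpow : 0 ≤ (1 - lipWeight a B) ^ j := pow_nonneg (by linarith) j
  rw [e, e, show ∀ u v : ℝ, (2 * C + 1) * ((1 - lipWeight a B) ^ j * u) - C -
    ((2 * C + 1) * ((1 - lipWeight a B) ^ j * v) - C) =
    (2 * C + 1) * (1 - lipWeight a B) ^ j * (u - v) by intros; ring, abs_mul,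
    abs_of_nonneg (by positivity)]
  exact mul_le_mul_of_nonneg_left (hgc.abs_sub_le x y) (by positivity)

theorem ContractiveDrift.tendsto_pow_zero (h : ContractiveDrift b δ a B) :
    Tendsto (fun j : ℕ => (1 - lipWeight a B) ^ j) atTop (𝓝 0) :=
  tendsto_pow_atTop_nhds_zero_of_lt_one
    (by linarith [lipWeight_le h.rate_pos h.error_nonneg])
    (by linarith [lipWeight_pos h.rate_pos h.error_nonneg])

/-- The chain forgets its starting law. The oscillation bound gives pointwise convergence and
boundedness of `f` gives domination, so no moment of `μ` is needed. -/
theorem ContractiveDrift.tendsto_integral_sub (h : ContractiveDrift b δ a B)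
    (hf : BddMeasurable f) (μ : Measure (Vec d)) [IsProbabilityMeasure μ] :
    Tendsto (fun j : ℕ => ∫ x, (evolve b δ)^[j * blockLength a δ] f x ∂μ -
      (evolve b δ)^[j * blockLength a δ] f 0) atTop (𝓝 0) := by
  have hb := h.continuous.measurable
  obtain ⟨c, -, hcb⟩ := hf.exists_abs_iterate_blocks_sub_le h
  obtain ⟨C, hC⟩ := hf.bounded
  have hIcc := fun k => iterate_evolve_mem_Icc (δ := δ) hb hf (fun x => abs_le.1 (hC x)) k
  have hlim : Tendsto (fun j : ℕ => ∫ x, ((evolve b δ)^[j * blockLength a δ] f x -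
      (evolve b δ)^[j * blockLength a δ] f 0) ∂μ) atTop (𝓝 (∫ _, (0 : ℝ) ∂μ)) := by
    refine tendsto_integral_of_dominated_convergence (fun _ => 2 * C)
      (fun j => ((hf.iterate_evolve hb _).sub (.const _)).measurable.aestronglyMeasurable)
      (integrable_const _) (fun j => ae_of_all _ fun x => ?_) (ae_of_all _ fun x => ?_)
    · have h1 := hIcc (j * blockLength a δ) x
      have h2 := hIcc (j * blockLength a δ) 0
      rw [Real.norm_eq_abs, abs_le]
      exact ⟨by linarith [h1.1, h2.2], by linarith [h1.2, h2.1]⟩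
    · refine squeeze_zero_norm (fun j => hcb j x 0) ?_
      have := (h.tendsto_pow_zero.const_mul c).mul_const (1 + lipWeight a B * ‖x - 0‖)
      simpa using this
  rw [integral_zero] at hlim
  refine hlim.congr fun j => ?_
  rw [integral_sub ((hf.iterate_evolve hb _).integrable μ) (integrable_const _)]
  simp

theorem IsInvariantLaw.tendsto_iterate_zero {π : Measure (Vec d)} (hπ : IsInvariantLaw b δ π)
    (h : ContractiveDrift b δ a B) (hf : BddMeasurable f) :
    Tendsto (fun j : ℕ => (evolve b δ)^[j * blockLength a δ] f 0) atTop (𝓝 (∫ x, f x ∂π)) := by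
  have := hπ.1
  have h1 := (h.tendsto_integral_sub hf π).const_sub (∫ x, f x ∂π)
  rw [sub_zero] at h1
  refine h1.congr fun j => ?_
  rw [hπ.integral_iterate_evolve h.continuous.measurable hf]
  ring

theorem bddMeasurable_boundedContinuous (f : BoundedContinuousFunction (Vec d) ℝ) :
    BddMeasurable (f : Vec d → ℝ) :=
  ⟨f.continuous.measurable, ‖f‖, fun x => by simpa using f.norm_coe_le_norm x⟩

/-- For every invariant law, the integral of `f` is the limit of the same sequence: the evolved `f`
at the origin along blocks. -/
theorem IsInvariantLaw.unique {π μ : Measure (Vec d)} (hπ : IsInvariantLaw b δ π)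
    (hμ : IsInvariantLaw b δ μ) (h : ContractiveDrift b δ a B) : μ = π := by
  have := hπ.1
  have := hμ.1
  exact ext_of_forall_integral_eq_of_IsFiniteMeasure fun f =>
    tendsto_nhds_unique (hμ.tendsto_iterate_zero h (bddMeasurable_boundedContinuous f))
      (hπ.tendsto_iterate_zero h (bddMeasurable_boundedContinuous f))

/-! ### Existence of an invariant law by tightness. -/

theorem continuous_evolve (hb : Continuous b) (f : BoundedContinuousFunction (Vec d) ℝ) :
    Continuous (evolve b δ f) := by
  refine continuous_of_dominated (bound := fun _ => ‖f‖) (fun x => by fun_prop)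
    (fun x => ae_of_all _ fun z => f.norm_coe_le_norm _) (integrable_const _)
    (ae_of_all _ fun z => by fun_prop)

/-- The law after `k` steps of the chain started at `0`. -/
noncomputable def chainLaw (b : Vec d → Vec d) (δ : ℝ) : ℕ → Measure (Vec d)
  | 0 => Measure.dirac 0
  | k + 1 => ((chainLaw b δ k).prod (stdGaussian (Vec d))).map (chainStep b δ)

theorem isProbabilityMeasure_chainLaw (hb : Measurable b) (k : ℕ) :
    IsProbabilityMeasure (chainLaw b δ k) := by
  induction k with
  | zero => rw [chainLaw]; infer_instance
  | succ k ih =>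
    rw [chainLaw]
    exact Measure.isProbabilityMeasure_map (measurable_chainStep hb).aemeasurable

theorem integral_chainLaw (hb : Measurable b) (hf : BddMeasurable f) (k : ℕ) :
    ∫ x, f x ∂(chainLaw b δ k) = (evolve b δ)^[k] f 0 := by
  induction k generalizing f with
  | zero => simp [chainLaw]
  | succ k ih =>
    have := isProbabilityMeasure_chainLaw (δ := δ) hb k
    rw [chainLaw, integral_map_chainStep hb _ hf, ih (hf.evolve hb), Function.iterate_succ_apply]

theorem ContractiveDrift.isTightMeasureSet_chainLaw (h : ContractiveDrift b δ a B) :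
    IsTightMeasureSet (Set.range (chainLaw b δ)) := by
  rw [isTightMeasureSet_iff_exists_isCompact_measure_compl_le]
  intro ε hε
  have hb := h.continuous.measurable
  set Q := momentBound d a B ‖b 0‖ with hQdef
  have hQ : 0 ≤ Q := momentBound_nonneg h.rate_pos
  obtain ⟨e, he0, heε⟩ : ∃ e : ℝ, 0 < e ∧ ENNReal.ofReal e ≤ ε := by
    rcases eq_or_ne ε ∞ with rfl | hε'
    · exact ⟨1, one_pos, le_top⟩
    · exact ⟨ε.toReal, ENNReal.toReal_pos hε.ne' hε', (ENNReal.ofReal_toReal hε').le⟩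
  -- Chosen so that `n e = Q + e ≥ Q`, as Markov's inequality requires.
  set n : ℝ := Q / e + 1 with hn
  have hn0 : 0 < n := by positivity
  refine ⟨Metric.closedBall 0 (√n), isCompact_closedBall _ _, ?_⟩
  rintro _ ⟨k, rfl⟩
  have := isProbabilityMeasure_chainLaw (δ := δ) hb k
  have hV := bddMeasurable_min_norm_sq (d := d) hn0.le
  have h1 := mul_meas_ge_le_integral_of_nonneg (μ := chainLaw b δ k)
    (ae_of_all _ fun x : Vec d => (by positivity : 0 ≤ min (‖x‖ ^ 2) n)) (hV.integrable _) n
  rw [integral_chainLaw hb hV] at h1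
  have h2 := h.iterate_min_norm_sq_le le_rfl hn0.le k 0
  have h3 := h.one_sub_pow_mul_momentBound_le (d := d) (K := ‖b 0‖) k
  have h4 : n * (chainLaw b δ k).real {x | n ≤ min (‖x‖ ^ 2) n} ≤ n * e := by
    have : n * e = Q + e := by rw [hn]; field_simp
    simp only [norm_zero, ne_eq, OfNat.ofNat_ne_zero, not_false_eq_true, zero_pow, mul_zero,
      zero_add] at h2
    linarith
  have h5 := le_of_mul_le_mul_left h4 hn0
  calc chainLaw b δ k (Metric.closedBall 0 √n)ᶜ
      ≤ chainLaw b δ k {x | n ≤ min (‖x‖ ^ 2) n} := by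
        refine measure_mono fun x hx => ?_
        simp only [Set.mem_compl_iff, Metric.mem_closedBall, dist_zero_right, not_le] at hx
        exact le_min (Real.sqrt_le_left (norm_nonneg x) |>.1 hx.le) le_rfl
    _ = ENNReal.ofReal ((chainLaw b δ k).real {x | n ≤ min (‖x‖ ^ 2) n}) := by
        rw [ofReal_measureReal]
    _ ≤ ε := (ENNReal.ofReal_le_ofReal h5).trans heε

/-- One additional step amounts to starting from the law after one step instead of from `0`, and the
starting law is forgotten. This makes limit points invariant without Cesàro averaging. -/
theorem ContractiveDrift.tendsto_evolve_sub (h : ContractiveDrift b δ a B)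
    (hf : BddMeasurable f) :
    Tendsto (fun j : ℕ => (evolve b δ)^[j * blockLength a δ] (evolve b δ f) 0 -
      (evolve b δ)^[j * blockLength a δ] f 0) atTop (𝓝 0) := by
  have hb := h.continuous.measurable
  have := isProbabilityMeasure_chainLaw (δ := δ) hb 1
  refine (h.tendsto_integral_sub hf (chainLaw b δ 1)).congr fun j => ?_
  rw [integral_chainLaw hb (hf.iterate_evolve hb _), ← Function.iterate_add_apply, add_comm,
    Function.iterate_add_apply, Function.iterate_one]

theorem ContractiveDrift.exists_isInvariantLaw (h : ContractiveDrift b δ a B) :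
    ∃ π, IsInvariantLaw b δ π := by
  have hb := h.continuous.measurable
  set ν : ℕ → ProbabilityMeasure (Vec d) := fun j =>
    ⟨chainLaw b δ (j * blockLength a δ), isProbabilityMeasure_chainLaw hb _⟩ with hν
  have hcompact : IsCompact (closure (Set.range ν)) := by
    refine isCompact_closure_of_isTightMeasureSet (h.isTightMeasureSet_chainLaw.subset ?_)
    rintro _ ⟨_, ⟨j, rfl⟩, rfl⟩
    exact ⟨_, rfl⟩
  -- A free ultrafilter replaces the extraction of a convergent subsequence.
  obtain ⟨π, -, hπ⟩ := hcompact.ultrafilter_le_nhds ((hyperfilter ℕ).map ν) (by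
    rw [Ultrafilter.coe_map]
    exact le_principal_iff.2 (mem_map.2 (univ_mem' fun j => subset_closure ⟨j, rfl⟩)))
  have hlim : Tendsto ν (hyperfilter ℕ) (𝓝 π) := hπ
  rw [ProbabilityMeasure.tendsto_iff_forall_integral_tendsto] at hlim
  have hle : (hyperfilter ℕ : Filter ℕ) ≤ atTop := Nat.hyperfilter_le_atTop
  have hinv : ((π : Measure (Vec d)).prod (stdGaussian (Vec d))).map (chainStep b δ) = π := by
    have := Measure.isProbabilityMeasure_map (μ := (π : Measure (Vec d)).prod (stdGaussian (Vec d)))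
      (measurable_chainStep (δ := δ) hb).aemeasurable
    refine ext_of_forall_integral_eq_of_IsFiniteMeasure fun f => ?_
    have hf := bddMeasurable_boundedContinuous f
    rw [integral_map_chainStep hb _ hf]
    let Pf : BoundedContinuousFunction (Vec d) ℝ :=
      .ofNormedAddCommGroup (evolve b δ f) (continuous_evolve h.continuous f) ‖f‖
        fun x => evolve_abs_le (fun y => by simpa using f.norm_coe_le_norm y) x
    have h1 := (hlim Pf).sub (hlim f)
    have h2 := (h.tendsto_evolve_sub hf).mono_left hle
    have h3 : (fun j => ∫ x, Pf x ∂(ν j : Measure (Vec d)) - ∫ x, f x ∂(ν j : Measure (Vec d))) =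
        fun j : ℕ => (evolve b δ)^[j * blockLength a δ] (evolve b δ f) 0 -
          (evolve b δ)^[j * blockLength a δ] f 0 := by
      ext j
      exact congrArg₂ _ (integral_chainLaw hb (hf.evolve hb) _) (integral_chainLaw hb hf _)
    rw [h3] at h1
    exact sub_eq_zero.1 (tendsto_nhds_unique h1 h2)
  refine ⟨π, inferInstance, fun A hA => ?_⟩
  rw [← map_chainStep_apply hb _ hA, hinv]

end invariant

end PnPULA

namespace PnPULA

/-! ### Perturbation of the drift -/

open Filter Topology

section perturbation

variable {d : ℕ} {b b' : Vec d → Vec d} {δ a B : ℝ} {f : Vec d → ℝ}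

/-- The contractive estimate carries an additive error that does not vanish as `x → y`, so it cannot
produce a bound proportional to `‖b - b'‖`. This cruder Gronwall bound does vanish, and its growth
stays bounded over one block. -/
theorem abs_iterate_evolve_sub_le_of_lipschitz {Λ c : ℝ} (hb : Measurable b) (hδ : 0 ≤ δ)
    (hΛ : 0 ≤ Λ) (hlipb : ∀ x y, ‖b x - b y‖ ≤ Λ * ‖x - y‖) (hf : BddMeasurable f) (hc : 0 ≤ c)
    (hlip : ∀ x y, |f x - f y| ≤ c * ‖x - y‖) (k : ℕ) (x y : Vec d) :
    |(evolve b δ)^[k] f x - (evolve b δ)^[k] f y| ≤ c * (1 + δ * Λ) ^ k * ‖x - y‖ := by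
  induction k generalizing x y with
  | zero => simpa using hlip x y
  | succ k ih =>
    simp_rw [Function.iterate_succ_apply']
    refine abs_evolve_sub_evolve_le (hf.iterate_evolve hb k) x y fun z => (ih _ _).trans ?_
    have h1 : ‖x + δ • b x + z - (y + δ • b y + z)‖ ≤ (1 + δ * Λ) * ‖x - y‖ := by
      have e : x + δ • b x + z - (y + δ • b y + z) = (x - y) + δ • (b x - b y) := by
        rw [smul_sub]; abel
      have h2 : ‖δ • (b x - b y)‖ ≤ δ * (Λ * ‖x - y‖) := by
        rw [norm_smul, Real.norm_of_nonneg hδ]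
        exact mul_le_mul_of_nonneg_left (hlipb x y) hδ
      rw [e]
      linarith [norm_add_le (x - y) (δ • (b x - b y))]
    rw [pow_succ, ← mul_assoc, mul_assoc (c * (1 + δ * Λ) ^ k)]
    exact mul_le_mul_of_nonneg_left h1 (by positivity)

theorem pow_le_exp_of_le_blockLength {Λ : ℝ} (ha : 0 < a) (hδ : 0 < δ) (haδ : a * δ ≤ 1)
    (hΛ : 0 ≤ Λ) {k : ℕ} (hk : k ≤ blockLength a δ) :
    (1 + δ * Λ) ^ k ≤ Real.exp (Λ * (2 / a)) := by
  have h1 : (1 + δ * Λ) ^ k ≤ Real.exp (δ * Λ) ^ k :=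
    pow_le_pow_left₀ (by positivity) (by linarith [Real.add_one_le_exp (δ * Λ)]) k
  rw [← Real.exp_nat_mul] at h1
  refine h1.trans (Real.exp_le_exp.2 ?_)
  have h2 : (k : ℝ) * δ ≤ 2 / a :=
    (mul_le_mul_of_nonneg_right (by exact_mod_cast hk) hδ.le).trans (blockLength_mul_le ha hδ haδ)
  calc (k : ℝ) * (δ * Λ) = Λ * (k * δ) := by ring
    _ ≤ Λ * (2 / a) := by gcongr

/-- Effect of changing the drift on Lipschitz test functions, over one block. -/
theorem IsInvariantLaw.abs_integral_sub_block_le_of_lipschitz {π : Measure (Vec d)}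
    (hπ : IsInvariantLaw b δ π) (hb : Measurable b) (h' : ContractiveDrift b' δ a B) {Λ c : ℝ}
    (hΛ : 0 ≤ Λ) (hlipb : ∀ x y, ‖b' x - b' y‖ ≤ Λ * ‖x - y‖) (hf : BddMeasurable f) (hc : 0 ≤ c)
    (hlip : ∀ x y, |f x - f y| ≤ c * ‖x - y‖) (hint : Integrable (fun x => ‖b x - b' x‖) π) :
    |∫ x, f x ∂π - ∫ x, (evolve b' δ)^[blockLength a δ] f x ∂π| ≤
      2 / a * (c * Real.exp (Λ * (2 / a))) * ∫ x, ‖b x - b' x‖ ∂π := by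
  have := hπ.1
  have hb' := h'.continuous.measurable
  have hδ := h'.step_pos
  set I := ∫ x, ‖b x - b' x‖ ∂π
  have hI : 0 ≤ I := integral_nonneg fun x => norm_nonneg _
  set E := c * Real.exp (Λ * (2 / a))
  have hE : 0 ≤ E := by positivity
  have key : ∀ k ≤ blockLength a δ,
      |∫ x, f x ∂π - ∫ x, (evolve b' δ)^[k] f x ∂π| ≤ k * δ * E * I := by
    intro k
    induction k with
    | zero => simp
    | succ k ih =>
      intro hk
      have h1 := ih (by lia)
      have hfk := hf.iterate_evolve (δ := δ) hb' k
      have h2 : |∫ x, (evolve b' δ)^[k] f x ∂π - ∫ x, (evolve b' δ)^[k + 1] f x ∂π| ≤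
          δ * E * I := by
        -- Invariance inserts a step of the first chain for free, so two steps from the same point
        -- are compared; they differ by `δ (b x - b' x)`.
        rw [← hπ.integral_evolve hb hfk, ← integral_sub ((hfk.evolve hb).integrable π)
          ((hf.iterate_evolve hb' (k + 1)).integrable π), ← integral_const_mul]
        refine norm_integral_le_of_norm_le (G := ℝ) (hint.const_mul (δ * E)) (ae_of_all _ fun x => ?_)
        rw [Real.norm_eq_abs, Function.iterate_succ_apply']
        refine abs_evolve_sub_evolve_le hfk x x fun z => ?_
        refine (abs_iterate_evolve_sub_le_of_lipschitz hb' hδ.le hΛ hlipb hf hc hlip k _ _).trans ?_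
        rw [show x + δ • b x + z - (x + δ • b' x + z) = δ • (b x - b' x) by rw [smul_sub]; abel, norm_smul, Real.norm_of_nonneg hδ.le]
        have h3 := pow_le_exp_of_le_blockLength h'.rate_pos hδ h'.rate_mul_step_le hΛ
          (by lia : k ≤ blockLength a δ)
        calc c * (1 + δ * Λ) ^ k * (δ * ‖b x - b' x‖)
            ≤ c * Real.exp (Λ * (2 / a)) * (δ * ‖b x - b' x‖) := by gcongr
          _ = δ * E * ‖b x - b' x‖ := by ring
      have h4 := abs_sub_le (∫ x, f x ∂π) (∫ x, (evolve b' δ)^[k] f x ∂π)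
        (∫ x, (evolve b' δ)^[k + 1] f x ∂π)
      push_cast
      linarith
  refine (key _ le_rfl).trans ?_
  have := blockLength_mul_le h'.rate_pos hδ h'.rate_mul_step_le
  gcongr

/-- The Donsker–Varadhan form of the relative entropy bound between the path laws of two chains
started from an invariant law of the first one. -/
theorem IsInvariantLaw.integral_le_log_integral_iterate {π : Measure (Vec d)}
    (hπ : IsInvariantLaw b δ π) (hb : Measurable b) (hb' : Measurable b') (hδ : 0 < δ)
    (hint : Integrable (fun x => ‖b x - b' x‖ ^ 2) π) (hf : BddMeasurable f) (k : ℕ) :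
    ∫ x, f x ∂π ≤ Real.log (∫ x, (evolve b' δ)^[k] (fun x => Real.exp (f x)) x ∂π)
      + k * δ / 4 * ∫ x, ‖b x - b' x‖ ^ 2 ∂π := by
  have := hπ.1
  have hlog := fun k => hf.log_iterate_evolve_exp (δ := δ) hb' k
  have hexp : ∀ k : ℕ, (fun x => Real.exp (Real.log ((evolve b' δ)^[k]
      (fun x => Real.exp (f x)) x))) = (evolve b' δ)^[k] (fun x => Real.exp (f x)) :=
    fun k => funext fun x => Real.exp_log (iterate_evolve_exp_pos hb' hf k x)
  have key : ∫ x, f x ∂π ≤ ∫ x, Real.log ((evolve b' δ)^[k] (fun x => Real.exp (f x)) x) ∂π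
      + k * δ / 4 * ∫ x, ‖b x - b' x‖ ^ 2 ∂π := by
    induction k with
    | zero => simp
    | succ k ih =>
      have h1 : ∫ x, Real.log ((evolve b' δ)^[k] (fun x => Real.exp (f x)) x) ∂π ≤
          ∫ x, (Real.log ((evolve b' δ)^[k + 1] (fun x => Real.exp (f x)) x) +
            δ / 4 * ‖b x - b' x‖ ^ 2) ∂π := by
        -- By stationarity of the first chain, each step costs the same mean entropy; this is the
        -- chain rule for relative entropy in dual form.
        rw [← hπ.integral_evolve hb (hlog k)]
        refine integral_mono (((hlog k).evolve hb).integrable π)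
          (((hlog (k + 1)).integrable π).add (hint.const_mul _)) fun x => ?_
        have h2 := evolve_le_log_evolve_exp (b := b) (b' := b') hδ (hlog k) x x 0
        rw [hexp k, ← Function.iterate_succ_apply' (evolve b' δ)] at h2
        simp only [add_zero] at h2
        have e : x + δ • b x - (x + δ • b' x) = δ • (b x - b' x) := by rw [smul_sub]; abel
        rw [e, norm_smul, Real.norm_of_nonneg hδ.le] at h2
        have e2 : (δ * ‖b x - b' x‖) ^ 2 / (4 * δ) = δ / 4 * ‖b x - b' x‖ ^ 2 := by
          field_simp
        rw [e2] at h2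
        exact h2
      rw [integral_add ((hlog (k + 1)).integrable π) (hint.const_mul _), integral_const_mul] at h1
      push_cast
      linarith
  -- Both chains start from `π`, so the initial laws cost no entropy and Jensen moves the logarithm
  -- outside.
  have h2 := integral_le_log_integral_exp π ((hlog k).integrable π) ((hlog k).exp.integrable π)
  rw [hexp k] at h2
  linarith

/-- Optimization of the free parameter in Pinsker's inequality. -/
theorem le_two_mul_sqrt_of_forall {X κ : ℝ} (hκ : 0 ≤ κ) (hX : X ≤ 1)
    (h : ∀ t, 0 < t → t ≤ 1 → t * X ≤ t ^ 2 + κ) : X ≤ 2 * √κ := by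
  have hs := Real.sq_sqrt hκ
  rcases hκ.eq_or_lt with rfl | hκ0
  · rw [Real.sqrt_zero, mul_zero]
    by_contra! hX0
    have h1 := h (X / 2) (by linarith) (by linarith)
    nlinarith
  · have hs0 := Real.sqrt_pos.2 hκ0
    rcases le_total 1 √κ with h1 | h1
    · linarith
    · have h2 := h √κ hs0 h1
      have : √κ * X ≤ √κ * (2 * √κ) := by linarith
      exact le_of_mul_le_mul_left this hs0

/-- Pinsker's inequality from the dual entropy bound: test with `t f`, use `exp u ≤ 1 + u + u²` for
`|u| ≤ 1` and `log r ≤ r - 1`, then optimize over `t ≤ 1`. -/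
theorem IsInvariantLaw.integral_sub_iterate_le {π : Measure (Vec d)}
    (hπ : IsInvariantLaw b δ π) (hb : Measurable b) (hb' : Measurable b') (hδ : 0 < δ)
    (hint : Integrable (fun x => ‖b x - b' x‖ ^ 2) π) (hf : BddMeasurable f)
    (hf01 : ∀ x, f x ∈ Set.Icc (0 : ℝ) 1) (k : ℕ) :
    ∫ x, f x ∂π - ∫ x, (evolve b' δ)^[k] f x ∂π ≤
      2 * √(k * δ / 4 * ∫ x, ‖b x - b' x‖ ^ 2 ∂π) := by
  have := hπ.1
  have hI : 0 ≤ ∫ x, ‖b x - b' x‖ ^ 2 ∂π := integral_nonneg fun x => by positivity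
  have hfk := hf.iterate_evolve (δ := δ) hb' k
  have hfk01 := iterate_evolve_mem_Icc (δ := δ) hb' hf hf01 k
  have h0 : 0 ≤ ∫ x, (evolve b' δ)^[k] f x ∂π := integral_nonneg fun x => (hfk01 x).1
  refine le_two_mul_sqrt_of_forall (by positivity) ?_ fun t ht ht1 => ?_
  · have h1 : ∫ x, f x ∂π ≤ ∫ _, (1 : ℝ) ∂π :=
      integral_mono (hf.integrable π) (integrable_const _) fun x => (hf01 x).2
    simp only [integral_const, probReal_univ, one_smul] at h1
    linarith
  · have h1 := hπ.integral_le_log_integral_iterate hb hb' hδ hint (hf.const_mul t) k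
    rw [integral_const_mul] at h1
    have hle : ∀ x, Real.exp (t * f x) ≤ (1 + t ^ 2) + t * f x := by
      intro x
      have hu0 : 0 ≤ t * f x := mul_nonneg ht.le (hf01 x).1
      have hut : t * f x ≤ t := mul_le_of_le_one_right ht.le (hf01 x).2
      have h2 := (abs_le.1 (Real.abs_exp_sub_one_sub_id_le
        (abs_le.2 ⟨by linarith, by linarith⟩ : |t * f x| ≤ 1))).2
      nlinarith
    have h3 : ∫ x, (evolve b' δ)^[k] (fun x => Real.exp (t * f x)) x ∂π ≤
        (1 + t ^ 2) + t * ∫ x, (evolve b' δ)^[k] f x ∂π := by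
      have h4 : ∫ x, (evolve b' δ)^[k] (fun x => Real.exp (t * f x)) x ∂π ≤
          ∫ x, ((1 + t ^ 2) + t * (evolve b' δ)^[k] f x) ∂π := by
        refine integral_mono (((hf.const_mul t).exp.iterate_evolve hb' k).integrable π)
          (((BddMeasurable.const _).add (hfk.const_mul t)).integrable π) fun x => ?_
        have h5 := iterate_evolve_mono (δ := δ) hb' (hf.const_mul t).exp
          ((BddMeasurable.const (1 + t ^ 2)).add (hf.const_mul t)) hle k x
        rwa [iterate_evolve_add hb' (.const _) (hf.const_mul _), iterate_evolve_const,
          iterate_evolve_const_mul] at h5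
      rw [integral_add (integrable_const _) ((hfk.integrable π).const_mul t),
        integral_const_mul] at h4
      simpa using h4
    have hpos : 0 < ∫ x, (evolve b' δ)^[k] (fun x => Real.exp (t * f x)) x ∂π := by
      have h5 : ∫ _, (1 : ℝ) ∂π ≤ ∫ x, (evolve b' δ)^[k] (fun x => Real.exp (t * f x)) x ∂π := by
        refine integral_mono (integrable_const _)
          (((hf.const_mul t).exp.iterate_evolve hb' k).integrable π) fun x => ?_
        have h6 := iterate_evolve_mono (δ := δ) hb' (.const 1) (hf.const_mul t).exp
          (fun x => Real.one_le_exp (mul_nonneg ht.le (hf01 x).1)) k x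
        rwa [iterate_evolve_const] at h6
      simp only [integral_const, probReal_univ, one_smul] at h5
      linarith
    have h6 := Real.log_le_sub_one_of_pos hpos
    linarith

theorem IsInvariantLaw.abs_integral_sub_iterate_le {π : Measure (Vec d)}
    (hπ : IsInvariantLaw b δ π) (hb : Measurable b) (hb' : Measurable b') (hδ : 0 < δ)
    (hint : Integrable (fun x => ‖b x - b' x‖ ^ 2) π) (hf : BddMeasurable f)
    (hf01 : ∀ x, f x ∈ Set.Icc (0 : ℝ) 1) (k : ℕ) :
    |∫ x, f x ∂π - ∫ x, (evolve b' δ)^[k] f x ∂π| ≤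
      2 * √(k * δ / 4 * ∫ x, ‖b x - b' x‖ ^ 2 ∂π) := by
  have := hπ.1
  have h1 := hπ.integral_sub_iterate_le hb hb' hδ hint hf hf01 k
  have h2 := hπ.integral_sub_iterate_le hb hb' hδ hint (f := fun x => 1 + -1 * f x)
    ((BddMeasurable.const 1).add (hf.const_mul (-1)))
    (fun x => ⟨by linarith [(hf01 x).2], by linarith [(hf01 x).1]⟩) k
  rw [iterate_evolve_add hb' (.const 1) (hf.const_mul _), iterate_evolve_const,
    iterate_evolve_const_mul, integral_add (integrable_const _) ((hf.integrable π).const_mul _),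
    integral_add (integrable_const _) (((hf.iterate_evolve hb' k).integrable π).const_mul _),
    integral_const_mul, integral_const_mul] at h2
  rw [abs_le]
  constructor <;> linarith

/-- The factor relating the distance of the invariant laws to that of the drifts. -/
noncomputable def perturbationConst (a B Λ : ℝ) : ℝ :=
  (2 / a * (lipWeight a B * Real.exp (Λ * (2 / a))) + 2 * √(1 / (2 * a))) / lipWeight a B

theorem perturbationConst_nonneg {Λ : ℝ} (ha : 0 < a) (hB : 0 ≤ B) :
    0 ≤ perturbationConst a B Λ := by
  have := lipWeight_pos ha hB
  unfold perturbationConst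
  positivity

theorem integral_norm_le_sqrt {μ : Measure (Vec d)} [IsProbabilityMeasure μ] {F : Vec d → Vec d}
    (hF : Continuous F) (hint : Integrable (fun x => ‖F x‖ ^ 2) μ) :
    Integrable (fun x => ‖F x‖) μ ∧ ∫ x, ‖F x‖ ∂μ ≤ √(∫ x, ‖F x‖ ^ 2 ∂μ) := by
  have h1 : Integrable (fun x => ‖F x‖) μ := by
    refine ((integrable_const (1 : ℝ)).add hint).mono' (by fun_prop) (ae_of_all _ fun x => ?_)
    rw [Real.norm_of_nonneg (norm_nonneg _)]
    simp only [Pi.add_apply]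
    nlinarith [sq_nonneg (‖F x‖ - 1 / 2)]
  refine ⟨h1, Real.le_sqrt_of_sq_le ?_⟩
  exact (convexOn_pow (𝕜 := ℝ) 2).map_integral_le (by fun_prop) isClosed_Ici
    (ae_of_all _ fun x => norm_nonneg _) h1 hint

theorem IsInvariantLaw.abs_integral_sub_block_le {π : Measure (Vec d)}
    (hπ : IsInvariantLaw b δ π) (hb : Continuous b) (h' : ContractiveDrift b' δ a B) {Λ : ℝ}
    (hΛ : 0 ≤ Λ) (hlipb : ∀ x y, ‖b' x - b' y‖ ≤ Λ * ‖x - y‖)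
    (hint : Integrable (fun x => ‖b x - b' x‖ ^ 2) π) (hf : LipschitzPlusUnit (lipWeight a B) f) :
    |∫ x, f x ∂π - ∫ x, (evolve b' δ)^[blockLength a δ] f x ∂π| ≤
      lipWeight a B * (perturbationConst a B Λ * √(∫ x, ‖b x - b' x‖ ^ 2 ∂π)) := by
  have := hπ.1
  obtain ⟨ψ, g, hψ, hg, hlip, hg01, rfl⟩ := hf
  have hb' := h'.continuous.measurable
  have ha := h'.rate_pos
  have hβ := lipWeight_pos ha h'.error_nonneg
  obtain ⟨hint1, hle1⟩ := integral_norm_le_sqrt (hb.sub h'.continuous) hint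
  have h1 := hπ.abs_integral_sub_block_le_of_lipschitz hb.measurable h' hΛ hlipb hψ hβ.le hlip hint1
  have h2 := hπ.abs_integral_sub_iterate_le hb.measurable hb' h'.step_pos hint hg hg01
    (blockLength a δ)
  set I := ∫ x, ‖b x - b' x‖ ^ 2 ∂π
  have hI : 0 ≤ I := integral_nonneg fun x => by positivity
  set N := blockLength a δ
  have h3 : √(N * δ / 4 * I) ≤ √(1 / (2 * a)) * √I := by
    rw [← Real.sqrt_mul (by positivity)]
    refine Real.sqrt_le_sqrt (mul_le_mul_of_nonneg_right ?_ hI)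
    have e : 1 / (2 * a) = 2 / a / 4 := by field_simp; norm_num
    rw [e]
    exact div_le_div_of_nonneg_right
      (blockLength_mul_le ha h'.step_pos h'.rate_mul_step_le) (by norm_num)
  have h4 : 2 / a * (lipWeight a B * Real.exp (Λ * (2 / a))) * ∫ x, ‖b x - b' x‖ ∂π ≤
      2 / a * (lipWeight a B * Real.exp (Λ * (2 / a))) * √I :=
    mul_le_mul_of_nonneg_left hle1 (by positivity)
  rw [iterate_evolve_add hb' hψ hg, integral_add (hψ.integrable π) (hg.integrable π),
    integral_add ((hψ.iterate_evolve hb' _).integrable π) ((hg.iterate_evolve hb' _).integrable π),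
    add_sub_add_comm]
  have e : lipWeight a B * (perturbationConst a B Λ * √I) =
      2 / a * (lipWeight a B * Real.exp (Λ * (2 / a))) * √I + 2 * (√(1 / (2 * a)) * √I) := by
    unfold perturbationConst
    field_simp
  rw [e]
  exact (abs_add_le _ _).trans (by linarith)

/-- Stability of the invariant law under a change of drift, for test functions which are sums of
a Lipschitz function and a function with values in `[0, 1]`. -/
theorem IsInvariantLaw.abs_integral_sub_integral_le {π π' : Measure (Vec d)}
    (hπ : IsInvariantLaw b δ π) (hπ' : IsInvariantLaw b' δ π') (hb : Continuous b)
    (h' : ContractiveDrift b' δ a B) {Λ : ℝ}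
    (hΛ : 0 ≤ Λ) (hlipb : ∀ x y, ‖b' x - b' y‖ ≤ Λ * ‖x - y‖)
    (hint : Integrable (fun x => ‖b x - b' x‖ ^ 2) π) (hf : LipschitzPlusUnit (lipWeight a B) f) :
    |∫ x, f x ∂π - ∫ x, f x ∂π'| ≤
      perturbationConst a B Λ * √(∫ x, ‖b x - b' x‖ ^ 2 ∂π) := by
  have := hπ.1
  have hb' := h'.continuous.measurable
  have ha := h'.rate_pos
  have hβ := lipWeight_pos ha h'.error_nonneg
  have hβ8 := lipWeight_le ha h'.error_nonneg
  have hfb := hf.bddMeasurable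
  set D := perturbationConst a B Λ * √(∫ x, ‖b x - b' x‖ ^ 2 ∂π) with hD
  have hD0 : 0 ≤ D := mul_nonneg (perturbationConst_nonneg ha h'.error_nonneg) (Real.sqrt_nonneg _)
  have hα : 0 ≤ 1 - lipWeight a B := by linarith
  -- Block `j` contributes at most `β (1 - β)^j D`; the division by `β` in `perturbationConst` makes
  -- the series sum to `D`.
  have key : ∀ j : ℕ, |∫ x, f x ∂π - ∫ x, (evolve b' δ)^[j * blockLength a δ] f x ∂π| ≤
      (1 - (1 - lipWeight a B) ^ j) * D := by
    intro j
    induction j with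
    | zero => simp
    | succ j ih =>
      obtain ⟨h, hh, heq⟩ :=
        hf.blocks hb' ha h'.error_nonneg h'.step_pos h'.rate_mul_step_le h'.step j
      have h1 := hπ.abs_integral_sub_block_le hb h' hΛ hlipb hint hh
      have h2 : (evolve b' δ)^[(j + 1) * blockLength a δ] f =
          fun x => (1 - lipWeight a B) ^ j * (evolve b' δ)^[blockLength a δ] h x := by
        rw [add_mul, one_mul, add_comm, Function.iterate_add_apply, heq, iterate_evolve_const_mul]
      rw [heq, integral_const_mul] at ih
      rw [h2, integral_const_mul]
      have h3 := mul_le_mul_of_nonneg_left h1 (pow_nonneg hα j)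
      rw [← abs_of_nonneg (pow_nonneg hα j), ← abs_mul, abs_of_nonneg (pow_nonneg hα j),
        mul_sub] at h3
      have h4 := abs_sub_le (∫ x, f x ∂π) ((1 - lipWeight a B) ^ j * ∫ x, h x ∂π)
        ((1 - lipWeight a B) ^ j * ∫ x, (evolve b' δ)^[blockLength a δ] h x ∂π)
      rw [pow_succ]
      linarith
  have hlim : Tendsto (fun j : ℕ => ∫ x, (evolve b' δ)^[j * blockLength a δ] f x ∂π) atTop
      (𝓝 (∫ x, f x ∂π')) := by
    have h1 := (h'.tendsto_integral_sub hfb π).add (hπ'.tendsto_iterate_zero h' hfb)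
    rw [zero_add] at h1
    exact h1.congr fun j => by ring
  refine le_of_tendsto (hlim.const_sub _).abs (Eventually.of_forall fun j => (key j).trans ?_)
  exact mul_le_of_le_one_left hD0 (by linarith [pow_nonneg hα j])

end perturbation

end PnPULA

namespace PnPULA

/-! ### Distances between laws -/

section distances

variable {d : ℕ}

theorem lintegral_enorm_le_sqrt (μ : Measure (Vec d)) :
    ∫⁻ x, ‖x‖ₑ ∂μ ≤ (∫⁻ x, ‖x‖ₑ ^ 2 ∂μ) ^ (1 / 2 : ℝ) * μ Set.univ ^ (1 / 2 : ℝ) := by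
  have h := ENNReal.lintegral_mul_le_Lp_mul_Lq μ Real.HolderConjugate.two_two
    (f := fun x : Vec d => ‖x‖ₑ) (g := fun _ => 1) (by fun_prop) (by fun_prop)
  simpa using h

/-- The Wasserstein distance is controlled by the total variation distance and second moments. -/
theorem wasserstein_le {μ ν : Measure (Vec d)} [IsProbabilityMeasure μ] [IsProbabilityMeasure ν]
    {D Q : ℝ≥0∞} (hD : ∀ A, MeasurableSet A → μ A ≤ ν A + D)
    (hμ : ∫⁻ x, ‖x‖ₑ ^ 2 ∂μ ≤ Q) (hν : ∫⁻ x, ‖x‖ₑ ^ 2 ∂ν ≤ Q) :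
    wasserstein μ ν ≤ 2 * (Q ^ (1 / 2 : ℝ) * D ^ (1 / 2 : ℝ)) := by
  set ξ := μ + ν with hξ
  have : SigmaFinite ξ := by rw [hξ]; infer_instance
  have : μ.HaveLebesgueDecomposition ξ := Measure.haveLebesgueDecomposition_of_sigmaFinite μ ξ
  have : ν.HaveLebesgueDecomposition ξ := Measure.haveLebesgueDecomposition_of_sigmaFinite ν ξ
  set p := μ.rnDeriv ξ with hp
  set q := ν.rnDeriv ξ with hq
  have hpm : Measurable p := Measure.measurable_rnDeriv _ _
  have hqm : Measurable q := Measure.measurable_rnDeriv _ _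
  have hμp : ξ.withDensity p = μ := Measure.withDensity_rnDeriv_eq _ _
    (Measure.AbsolutelyContinuous.rfl.add_right ν)
  have hνq : ξ.withDensity q = ν := Measure.withDensity_rnDeriv_eq _ _
    ((Measure.AbsolutelyContinuous.rfl.add_right μ).trans (by rw [hξ, add_comm]))
  -- The maximal coupling: the common part stays on the diagonal, and the excesses `μ'` and `ν'`, of
  -- equal mass `s`, are coupled as a normalized product. Only the excesses are transported, and
  -- Cauchy–Schwarz bounds their first moments by the second moments and `s ≤ D`.
  set κ := ξ.withDensity fun x => min (p x) (q x) with hκ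
  set μ' := ξ.withDensity fun x => p x - q x with hμ'
  set ν' := ξ.withDensity fun x => q x - p x with hν'
  have hκμ : κ + μ' = μ := by
    rw [hκ, hμ', ← withDensity_add_left (by fun_prop)]
    conv_rhs => rw [← hμp]
    congr 1
    ext x
    rcases le_total (p x) (q x) with h | h
    · simp [h, tsub_eq_zero_of_le h]
    · simp [h]
  have hκν : κ + ν' = ν := by
    rw [hκ, hν', ← withDensity_add_left (by fun_prop)]
    conv_rhs => rw [← hνq]
    congr 1
    ext x
    rcases le_total (p x) (q x) with h | h
    · simp [h]
    · simp [h, tsub_eq_zero_of_le h]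
  have hμ'le : μ' ≤ μ := by rw [← hκμ]; exact Measure.le_add_left le_rfl
  have hν'le : ν' ≤ ν := by rw [← hκν]; exact Measure.le_add_left le_rfl
  have hκle : κ ≤ μ := by rw [← hκμ]; exact Measure.le_add_right le_rfl
  have : IsFiniteMeasure μ' := isFiniteMeasure_of_le μ hμ'le
  have : IsFiniteMeasure ν' := isFiniteMeasure_of_le ν hν'le
  have : IsFiniteMeasure κ := isFiniteMeasure_of_le μ hκle
  set s := μ' Set.univ with hs
  have hs' : ν' Set.univ = s := by
    have h1 : κ Set.univ + μ' Set.univ = κ Set.univ + ν' Set.univ := by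
      rw [← Measure.add_apply, ← Measure.add_apply, hκμ, hκν, measure_univ, measure_univ]
    exact ((ENNReal.add_right_inj (measure_ne_top κ _)).1 h1).symm
  have hsD : s ≤ D := by
    have hA : MeasurableSet {x | q x < p x} := measurableSet_lt hqm hpm
    have h1 : μ' {x | q x < p x}ᶜ = 0 := by
      rw [hμ', withDensity_apply _ hA.compl]
      refine (setLIntegral_congr_fun hA.compl fun x hx => ?_).trans lintegral_zero
      exact tsub_eq_zero_of_le (not_lt.1 hx)
    have h2 : ν' {x | q x < p x} = 0 := by
      rw [hν', withDensity_apply _ hA]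
      refine (setLIntegral_congr_fun hA fun x hx => ?_).trans lintegral_zero
      exact tsub_eq_zero_of_le (le_of_lt hx)
    have h3 : s = μ' {x | q x < p x} := by
      rw [hs, ← measure_add_measure_compl hA, h1, add_zero]
    have h4 := hD _ hA
    rw [← hκμ, ← hκν, Measure.add_apply, Measure.add_apply, h2, add_zero, ← h3] at h4
    exact (ENNReal.add_le_add_iff_left (measure_ne_top κ _)).1 h4
  have hsfin : s ≠ ∞ := measure_ne_top μ' _
  have hsmul : ∀ ρ : Measure (Vec d), ρ Set.univ = s → s⁻¹ • (s • ρ) = ρ := by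
    intro ρ hρ
    rcases eq_or_ne s 0 with h0 | h0
    · have : ρ = 0 := by rw [← Measure.measure_univ_eq_zero, hρ, h0]
      simp [this]
    · rw [smul_smul, ENNReal.inv_mul_cancel h0 hsfin, one_smul]
  have hdiag : Measurable fun x : Vec d => (x, x) := by fun_prop
  set γ : Measure (Vec d × Vec d) := κ.map (fun x => (x, x)) + s⁻¹ • μ'.prod ν' with hγ
  have hfst : γ.map Prod.fst = μ := by
    rw [hγ, Measure.map_add _ _ measurable_fst, Measure.map_map measurable_fst hdiag,
      Measure.map_smul, Measure.map_fst_prod, hs', hsmul μ' rfl]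
    conv_rhs => rw [← hκμ]
    congr 1
    exact Measure.map_id
  have hsnd : γ.map Prod.snd = ν := by
    rw [hγ, Measure.map_add _ _ measurable_snd, Measure.map_map measurable_snd hdiag,
      Measure.map_smul, Measure.map_snd_prod, ← hs, hsmul ν' hs']
    conv_rhs => rw [← hκν]
    congr 1
    exact Measure.map_id
  have hcost : ∫⁻ z, ‖z.1 - z.2‖ₑ ∂γ ≤ ∫⁻ x, ‖x‖ₑ ∂μ' + ∫⁻ x, ‖x‖ₑ ∂ν' := by
    have h1 : ∫⁻ z, ‖z.1 - z.2‖ₑ ∂(κ.map fun x : Vec d => (x, x)) = 0 := by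
      rw [lintegral_map (by fun_prop) hdiag]
      simp
    have h2 : ∫⁻ z, ‖z.1 - z.2‖ₑ ∂(μ'.prod ν') ≤
        s * (∫⁻ x, ‖x‖ₑ ∂μ' + ∫⁻ x, ‖x‖ₑ ∂ν') := by
      calc ∫⁻ z, ‖z.1 - z.2‖ₑ ∂(μ'.prod ν')
          ≤ ∫⁻ z, (‖z.1‖ₑ + ‖z.2‖ₑ) ∂(μ'.prod ν') :=
            lintegral_mono fun z => enorm_sub_le
        _ = s * (∫⁻ x, ‖x‖ₑ ∂μ' + ∫⁻ x, ‖x‖ₑ ∂ν') := by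
            rw [lintegral_add_left (by fun_prop), mul_add, ← lintegral_map
              (f := fun x : Vec d => ‖x‖ₑ) (g := Prod.fst) (by fun_prop) measurable_fst,
              ← lintegral_map (f := fun x : Vec d => ‖x‖ₑ) (g := Prod.snd) (by fun_prop)
              measurable_snd, Measure.map_fst_prod, Measure.map_snd_prod, hs', ← hs,
              lintegral_smul_measure, lintegral_smul_measure, smul_eq_mul, smul_eq_mul]
    rw [hγ, lintegral_add_measure, h1, zero_add, lintegral_smul_measure, smul_eq_mul]
    calc s⁻¹ * ∫⁻ z, ‖z.1 - z.2‖ₑ ∂(μ'.prod ν')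
        ≤ s⁻¹ * (s * (∫⁻ x, ‖x‖ₑ ∂μ' + ∫⁻ x, ‖x‖ₑ ∂ν')) := by gcongr
      _ = (s⁻¹ * s) * (∫⁻ x, ‖x‖ₑ ∂μ' + ∫⁻ x, ‖x‖ₑ ∂ν') := by rw [mul_assoc]
      _ ≤ 1 * (∫⁻ x, ‖x‖ₑ ∂μ' + ∫⁻ x, ‖x‖ₑ ∂ν') := by
          gcongr
          exact ENNReal.inv_mul_le_one s
      _ = _ := one_mul _
  have hbound : ∀ ρ' ρ : Measure (Vec d), ρ' ≤ ρ → ρ' Set.univ = s → ∫⁻ x, ‖x‖ₑ ^ 2 ∂ρ ≤ Q →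
      ∫⁻ x, ‖x‖ₑ ∂ρ' ≤ Q ^ (1 / 2 : ℝ) * D ^ (1 / 2 : ℝ) := by
    intro ρ' ρ hle hu hQ
    refine (lintegral_enorm_le_sqrt ρ').trans ?_
    rw [hu]
    gcongr
    exact (lintegral_mono' hle le_rfl).trans hQ
  calc wasserstein μ ν ≤ ∫⁻ z, ‖z.1 - z.2‖ₑ ∂γ := iInf₂_le_of_le γ hfst (iInf_le _ hsnd)
    _ ≤ ∫⁻ x, ‖x‖ₑ ∂μ' + ∫⁻ x, ‖x‖ₑ ∂ν' := hcost
    _ ≤ _ := by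
      rw [two_mul]
      exact add_le_add (hbound μ' μ hμ'le rfl hμ) (hbound ν' ν hν'le hs' hν)

theorem tvDist_le {μ ν : Measure (Vec d)} [IsProbabilityMeasure μ] [IsProbabilityMeasure ν]
    {D : ℝ} (hD : ∀ f : Vec d → ℝ, BddMeasurable f → (∀ x, f x ∈ Set.Icc (0 : ℝ) 1) →
      |∫ x, f x ∂μ - ∫ x, f x ∂ν| ≤ D) :
    tvDist μ ν ≤ ENNReal.ofReal (2 * D) := by
  refine iSup_le fun f => iSup_le fun hf => iSup_le fun hf1 => ENNReal.ofReal_le_ofReal ?_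
  have hfb : BddMeasurable f := ⟨hf, 1, hf1⟩
  -- Halving maps `[-1,1]` onto `[0,1]`, whence the factor `2`.
  have h := hD (fun x => 1 / 2 + 1 / 2 * f x) ((BddMeasurable.const _).add (hfb.const_mul _))
    fun x => by
      have := abs_le.1 (hf1 x)
      constructor <;> linarith
  rw [integral_add (integrable_const _) ((hfb.integrable μ).const_mul _),
    integral_add (integrable_const _) ((hfb.integrable ν).const_mul _), integral_const_mul,
    integral_const_mul] at h
  simp only [integral_const, probReal_univ, one_smul] at h
  rw [add_sub_add_left_eq_sub, ← mul_sub, abs_mul, abs_of_pos (by norm_num : (0 : ℝ) < 1 / 2)] at h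
  linarith

theorem measure_le_add_of_abs_integral_sub_le {μ ν : Measure (Vec d)} [IsProbabilityMeasure μ]
    [IsProbabilityMeasure ν] {D : ℝ}
    (hD : ∀ f : Vec d → ℝ, BddMeasurable f → (∀ x, f x ∈ Set.Icc (0 : ℝ) 1) →
      |∫ x, f x ∂μ - ∫ x, f x ∂ν| ≤ D) {A : Set (Vec d)} (hA : MeasurableSet A) :
    μ A ≤ ν A + ENNReal.ofReal D := by
  have h01 : ∀ x, A.indicator (fun _ => (1 : ℝ)) x ∈ Set.Icc (0 : ℝ) 1 := fun x => by
    by_cases hx : x ∈ A <;> simp [hx]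
  have h := hD (A.indicator fun _ => 1) ⟨measurable_const.indicator hA, 1, fun x =>
    abs_le.2 ⟨by linarith [(h01 x).1], (h01 x).2⟩⟩ h01
  rw [integral_indicator_const _ hA, integral_indicator_const _ hA] at h
  simp only [smul_eq_mul, mul_one] at h
  have hD0 : 0 ≤ D := (abs_nonneg _).trans h
  rw [← ofReal_measureReal (μ := μ), ← ofReal_measureReal (μ := ν),
    ← ENNReal.ofReal_add measureReal_nonneg hD0]
  exact ENNReal.ofReal_le_ofReal (by linarith [(abs_le.1 h).2])

theorem posteriorL2_eq {π : Measure (Vec d)} {b b' : Vec d → Vec d}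
    (hint : Integrable (fun x => ‖b x - b' x‖ ^ 2) π) :
    posteriorL2 π b b' = ENNReal.ofReal √(∫ x, ‖b x - b' x‖ ^ 2 ∂π) := by
  have h0 : 0 ≤ ∫ x, ‖b x - b' x‖ ^ 2 ∂π := integral_nonneg fun x => by positivity
  rw [Real.sqrt_eq_rpow, ← ENNReal.ofReal_rpow_of_nonneg h0 (by norm_num), posteriorL2,
    ofReal_integral_eq_lintegral_ofReal hint (ae_of_all _ fun x => by positivity)]
  simp_rw [ENNReal.ofReal_pow (norm_nonneg _), ofReal_norm]

end distances

end PnPULA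

namespace PnPULA

/-! ### The drift of the chain -/

section drift

variable {d n : ℕ} {S : Set (Vec d)}

theorem norm_proj_sub_proj_le_diam (hS : IsCompact S) (hne : S.Nonempty) (x y : Vec d) :
    ‖proj S x - proj S y‖ ≤ Metric.diam S := by
  rw [← dist_eq_norm]
  exact Metric.dist_le_diam_of_mem hS.isBounded (proj_spec hS hne x).1 (proj_spec hS hne y).1

theorem inner_sub_proj_le (hS : IsCompact S) (hne : S.Nonempty) (hc : Convex ℝ S) (x : Vec d)
    {w : Vec d} (hw : w ∈ S) : inner ℝ (x - proj S x) (w - proj S x) ≤ 0 := by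
  obtain ⟨hm, hd⟩ := proj_spec hS hne x
  refine (norm_eq_iInf_iff_real_inner_le_zero hc hm).1 ?_ w hw
  rw [← dist_eq_norm, hd, Metric.infDist_eq_iInf]
  simp_rw [dist_eq_norm]

/-- Add the two variational inequalities, then apply Cauchy–Schwarz. -/
theorem norm_proj_sub_proj_le (hS : IsCompact S) (hne : S.Nonempty) (hc : Convex ℝ S)
    (x y : Vec d) : ‖proj S x - proj S y‖ ≤ ‖x - y‖ := by
  have h1 := inner_sub_proj_le hS hne hc x (proj_spec hS hne y).1
  have h2 := inner_sub_proj_le hS hne hc y (proj_spec hS hne x).1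
  have h3 : ‖proj S x - proj S y‖ ^ 2 ≤ inner ℝ (x - y) (proj S x - proj S y) := by
    have e : inner ℝ (x - y) (proj S x - proj S y) - ‖proj S x - proj S y‖ ^ 2 =
        -(inner ℝ (x - proj S x) (proj S y - proj S x) +
          inner ℝ (y - proj S y) (proj S x - proj S y)) := by
      rw [← real_inner_self_eq_norm_sq]
      simp only [inner_sub_left, inner_sub_right, real_inner_comm]
      ring
    linarith
  have h4 := real_inner_le_norm (x - y) (proj S x - proj S y)
  rcases (norm_nonneg (proj S x - proj S y)).eq_or_lt with h0 | h0
  · rw [← h0]; exact norm_nonneg _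
  · exact le_of_mul_le_mul_right (by rw [← sq]; exact h3.trans h4) h0

variable {L M ε₀ ε lam δ : ℝ} {y : Vec n} {p : Vec n → Vec d → ℝ} {D : ℝ → Vec d → Vec d}

theorem norm_drift_sub_le (hS : IsCompact S) (hne : S.Nonempty) (hc : Convex ℝ S)
    (hε : 0 < ε) (hεε₀ : ε ≤ ε₀) (hlam : 0 < lam) (hp : SmoothLikelihood L p)
    (hD : LipschitzDenoiser ε₀ M D) (x z : Vec d) :
    ‖drift p y D S ε lam x - drift p y D S ε lam z‖ ≤
      (L + (M + 1) / ε + 2 / lam) * ‖x - z‖ := by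
  have e : drift p y D S ε lam x - drift p y D S ε lam z =
      (score p y x - score p y z) + (1 / ε) • ((D ε x - D ε z) - (x - z)) +
        (1 / lam) • ((proj S x - proj S z) - (x - z)) := by
    unfold drift
    module
  have h1 := hp.lipschitz y x z
  have h2 : ‖(1 / ε) • ((D ε x - D ε z) - (x - z))‖ ≤ 1 / ε * (M * ‖x - z‖ + ‖x - z‖) := by
    rw [norm_smul, Real.norm_of_nonneg (by positivity)]
    gcongr
    exact (norm_sub_le _ _).trans (by linarith [hD ε hε hεε₀ x z])
  have h3 : ‖(1 / lam) • ((proj S x - proj S z) - (x - z))‖ ≤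
      1 / lam * (‖x - z‖ + ‖x - z‖) := by
    rw [norm_smul, Real.norm_of_nonneg (by positivity)]
    gcongr
    exact (norm_sub_le _ _).trans (by linarith [norm_proj_sub_proj_le hS hne hc x z])
  rw [e]
  refine (norm_add₃_le).trans ?_
  have e2 : (L + (M + 1) / ε + 2 / lam) * ‖x - z‖ = L * ‖x - z‖ +
      1 / ε * (M * ‖x - z‖ + ‖x - z‖) + 1 / lam * (‖x - z‖ + ‖x - z‖) := by ring
  linarith

/-- The projections contribute only a bounded error, through the diameter of `S`. This leaves the
full pull `-1/lam` on `x - z`, half of which compensates the score and the denoiser. Using that the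
projection is nonexpansive would cancel the pull. -/
theorem norm_drift_step_sub_le (hS : IsCompact S) (hne : S.Nonempty)
    (hε : 0 < ε) (hεε₀ : ε ≤ ε₀) (hlam : 0 < lam) (hp : SmoothLikelihood L p)
    (hD : LipschitzDenoiser ε₀ M D) (hlam_small : L + (M + 1) / ε ≤ 1 / (2 * lam))
    (hδ : 0 < δ) (hδlam : δ ≤ lam) (x z : Vec d) :
    ‖x + δ • drift p y D S ε lam x - (z + δ • drift p y D S ε lam z)‖ ≤
      (1 - 1 / (2 * lam) * δ) * ‖x - z‖ + δ * (Metric.diam S / lam) := by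
  have e : x + δ • drift p y D S ε lam x - (z + δ • drift p y D S ε lam z) =
      (1 - δ / lam) • (x - z) + δ • ((score p y x - score p y z) +
        (1 / ε) • ((D ε x - D ε z) - (x - z))) + (δ / lam) • (proj S x - proj S z) := by
    unfold drift
    module
  have h0 : 0 ≤ 1 - δ / lam := by
    rw [sub_nonneg, div_le_one hlam]
    exact hδlam
  have h1 : ‖(1 - δ / lam) • (x - z)‖ = (1 - δ / lam) * ‖x - z‖ := by
    rw [norm_smul, Real.norm_of_nonneg h0]
  have h2 : ‖(score p y x - score p y z) + (1 / ε) • ((D ε x - D ε z) - (x - z))‖ ≤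
      1 / (2 * lam) * ‖x - z‖ := by
    have h3 : ‖(1 / ε) • ((D ε x - D ε z) - (x - z))‖ ≤ 1 / ε * (M * ‖x - z‖ + ‖x - z‖) := by
      rw [norm_smul, Real.norm_of_nonneg (by positivity)]
      gcongr
      exact (norm_sub_le _ _).trans (by linarith [hD ε hε hεε₀ x z])
    have h4 := mul_le_mul_of_nonneg_right hlam_small (norm_nonneg (x - z))
    have e2 : (L + (M + 1) / ε) * ‖x - z‖ =
        L * ‖x - z‖ + 1 / ε * (M * ‖x - z‖ + ‖x - z‖) := by ring
    linarith [norm_add_le (score p y x - score p y z) ((1 / ε) • ((D ε x - D ε z) - (x - z))),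
      hp.lipschitz y x z]
  have h5 : ‖δ • ((score p y x - score p y z) + (1 / ε) • ((D ε x - D ε z) - (x - z)))‖ ≤
      δ * (1 / (2 * lam) * ‖x - z‖) := by
    rw [norm_smul, Real.norm_of_nonneg hδ.le]
    gcongr
  have h6 : ‖(δ / lam) • (proj S x - proj S z)‖ ≤ δ / lam * Metric.diam S := by
    rw [norm_smul, Real.norm_of_nonneg (by positivity)]
    gcongr
    exact norm_proj_sub_proj_le_diam hS hne x z
  rw [e]
  refine (norm_add₃_le).trans ?_
  have e3 : (1 - 1 / (2 * lam) * δ) * ‖x - z‖ + δ * (Metric.diam S / lam) =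
      (1 - δ / lam) * ‖x - z‖ + δ * (1 / (2 * lam) * ‖x - z‖) + δ / lam * Metric.diam S := by
    field_simp
    ring
  linarith

theorem contractiveDrift_drift (hS : IsCompact S) (hne : S.Nonempty) (hc : Convex ℝ S)
    (hε : 0 < ε) (hεε₀ : ε ≤ ε₀) (hlam : 0 < lam) (hL : 0 ≤ L) (hM : 0 ≤ M)
    (hp : SmoothLikelihood L p) (hD : LipschitzDenoiser ε₀ M D)
    (hlam_small : L + (M + 1) / ε ≤ 1 / (2 * lam)) (hδ : 0 < δ) (hδlam : δ ≤ lam) :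
    ContractiveDrift (drift p y D S ε lam) δ (1 / (2 * lam)) (Metric.diam S / lam) where
  continuous := by
    have : LipschitzWith (Real.toNNReal (L + (M + 1) / ε + 2 / lam)) (drift p y D S ε lam) :=
      LipschitzWith.of_dist_le_mul fun x z => by
        rw [dist_eq_norm, dist_eq_norm, Real.coe_toNNReal _ (by positivity)]
        exact norm_drift_sub_le hS hne hc hε hεε₀ hlam hp hD x z
    exact this.continuous
  rate_pos := by positivity
  error_nonneg := div_nonneg Metric.diam_nonneg hlam.le
  step_pos := hδ
  rate_mul_step_le := by
    rw [one_div, inv_mul_le_iff₀ (by positivity)]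
    linarith
  step := norm_drift_step_sub_le hS hne hε hεε₀ hlam hp hD hlam_small hδ hδlam

theorem integrable_norm_sub_sq {b b' : Vec d → Vec d} {π : Measure (Vec d)} [IsFiniteMeasure π]
    {Λ : ℝ} (hb : Continuous b) (hb' : Continuous b')
    (hlip : ∀ x z, ‖b x - b z‖ ≤ Λ * ‖x - z‖) (hlip' : ∀ x z, ‖b' x - b' z‖ ≤ Λ * ‖x - z‖)
    (hπ : Integrable (fun x => ‖x‖ ^ 2) π) : Integrable (fun x => ‖b x - b' x‖ ^ 2) π := by
  refine ((integrable_const (2 * ‖b 0 - b' 0‖ ^ 2)).add (hπ.const_mul (2 * (2 * Λ) ^ 2))).mono'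
    (by fun_prop) (ae_of_all _ fun x => ?_)
  rw [Real.norm_of_nonneg (by positivity)]
  have h1 : ‖b x - b' x‖ ≤ ‖b 0 - b' 0‖ + 2 * Λ * ‖x‖ := by
    have e : b x - b' x = (b 0 - b' 0) + (b x - b 0) - (b' x - b' 0) := by abel
    have h2 := hlip x 0
    have h3 := hlip' x 0
    rw [sub_zero] at h2 h3
    rw [e]
    linarith [norm_sub_le ((b 0 - b' 0) + (b x - b 0)) (b' x - b' 0),
      norm_add_le (b 0 - b' 0) (b x - b 0)]
  have h2 : ‖b x - b' x‖ ^ 2 ≤ (‖b 0 - b' 0‖ + 2 * Λ * ‖x‖) ^ 2 := by gcongr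
  simp only [Pi.add_apply]
  nlinarith [sq_nonneg (‖b 0 - b' 0‖ - 2 * Λ * ‖x‖)]

end drift

end PnPULA

/-! ### Assembly of the main theorem. -/

theorem theorem1 (d : ℕ) (L M ε₀ ε lam m K : ℝ) (S : Set (PnPULA.Vec d))
    (hL : 0 < L) (hM : 0 ≤ M) (hε : 0 < ε) (hεε₀ : ε ≤ ε₀) (hlam : 0 < lam)
    (hS_ne : S.Nonempty) (hS_compact : IsCompact S) (hS_convex : Convex ℝ S)
    (hlam_small : 2 * lam * (L + (M + 1) / ε - min m 0) ≤ 1) :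
    ∃ A₀ B₀ A₁ B₁ : ℝ≥0,
      ∀ (n : ℕ) (y : PnPULA.Vec n)
        (prior : Fin 2 → Measure (PnPULA.Vec d))
        (p : Fin 2 → PnPULA.Vec n → PnPULA.Vec d → ℝ)
        (D : Fin 2 → ℝ → PnPULA.Vec d → PnPULA.Vec d)
        (b : Fin 2 → PnPULA.Vec d → PnPULA.Vec d),
        (∀ i, IsProbabilityMeasure (prior i)) →
        (∀ i, PnPULA.FiniteSecondMoment (prior i)) →
        (∀ i, PnPULA.SmoothLikelihood L (p i)) →
        (∀ i, PnPULA.LipschitzDenoiser ε₀ M (D i)) →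
        (∀ i, PnPULA.OneSidedLipschitzScore m (p i) y) →
        (∀ i, b i = PnPULA.drift (p i) y (D i) S ε lam) →
        (∀ i, ‖b i 0‖ ≤ K) →
        ∀ δ : ℝ, 0 < δ → δ ≤ 1 / 3 * (L + (M + 1) / ε + 1 / lam)⁻¹ →
          ∃ π : Fin 2 → Measure (PnPULA.Vec d),
            (∀ i, PnPULA.IsInvariantLaw (b i) δ (π i) ∧
              ∀ μ, PnPULA.IsInvariantLaw (b i) δ μ → μ = π i) ∧
            PnPULA.posteriorL2 (π 0) (b 0) (b 1) < ∞ ∧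
            PnPULA.tvDist (π 0) (π 1) ≤
              A₀ * PnPULA.posteriorL2 (π 0) (b 0) (b 1)
                + B₀ * ENNReal.ofReal (δ ^ (1 / 4 : ℝ)) ∧
            PnPULA.wasserstein (π 0) (π 1) ≤
              A₁ * PnPULA.posteriorL2 (π 0) (b 0) (b 1) ^ (1 / 2 : ℝ)
                + B₁ * ENNReal.ofReal (δ ^ (1 / 8 : ℝ)) := by
  set a : ℝ := 1 / (2 * lam) with ha
  set B : ℝ := Metric.diam S / lam with hB
  set Λ : ℝ := L + (M + 1) / ε + 2 / lam with hΛ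
  set C : ℝ := PnPULA.perturbationConst a B Λ with hC
  set Q : ℝ := PnPULA.momentBound d a B K with hQ
  have hΛ0 : 0 ≤ Λ := by positivity
  have hB0 : 0 ≤ B := div_nonneg Metric.diam_nonneg hlam.le
  have hC0 : 0 ≤ C := PnPULA.perturbationConst_nonneg (by positivity) hB0
  have hsmall : L + (M + 1) / ε ≤ a := by
    rw [ha, le_div_iff₀ (by positivity)]
    have h1 : 2 * lam * min m 0 ≤ 0 :=
      mul_nonpos_of_nonneg_of_nonpos (by positivity) (min_le_right _ _)
    linarith
  -- Test functions in `[0,1]` give the distance `C d₁`; the total variation norm doubles it, and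
  -- the transport bound is `2 √Q √(C d₁)`. Only `Q` depends on `K`.
  refine ⟨(2 * C).toNNReal, 0, (2 * (√Q * √C)).toNNReal, 0, ?_⟩
  intro n y prior p D b _ _ hp hD _ hb hK δ hδ hδ_le
  obtain rfl : b = fun i => PnPULA.drift (p i) y (D i) S ε lam := funext hb
  have hδlam : δ ≤ lam := by
    have h1 : (L + (M + 1) / ε + 1 / lam)⁻¹ ≤ lam := by
      rw [inv_le_comm₀ (by positivity) hlam, ← one_div]
      have : 0 ≤ L + (M + 1) / ε := by positivity
      linarith
    linarith
  have hcontr : ∀ i, PnPULA.ContractiveDrift (PnPULA.drift (p i) y (D i) S ε lam) δ a B := fun i =>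
    PnPULA.contractiveDrift_drift hS_compact hS_ne hS_convex hε hεε₀ hlam hL.le hM (hp i) (hD i)
      hsmall hδ hδlam
  have hlip := fun i => PnPULA.norm_drift_sub_le (y := y) hS_compact hS_ne hS_convex hε hεε₀ hlam
    (hp i) (hD i)
  choose π hπ using fun i => (hcontr i).exists_isInvariantLaw
  have := (hπ 0).1
  have := (hπ 1).1
  have hint := PnPULA.integrable_norm_sub_sq (hcontr 0).continuous (hcontr 1).continuous
    (hlip 0) (hlip 1) ((hπ 0).integrable_norm_sq (hcontr 0))
  have hdist : ∀ f : PnPULA.Vec d → ℝ, PnPULA.BddMeasurable f →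
      (∀ x, f x ∈ Set.Icc (0 : ℝ) 1) → |∫ x, f x ∂(π 0) - ∫ x, f x ∂(π 1)| ≤ C * _ :=
    fun f hf hf01 => (hπ 0).abs_integral_sub_integral_le (hπ 1) (hcontr 0).continuous (hcontr 1)
      hΛ0 (hlip 1) hint
      (.of_mem_Icc (PnPULA.lipWeight_pos (by positivity) hB0).le hf hf01)
  refine ⟨π, fun i => ⟨hπ i, fun μ hμ => (hπ i).unique hμ (hcontr i)⟩, ?_, ?_, ?_⟩
  · rw [PnPULA.posteriorL2_eq hint]
    exact ENNReal.ofReal_lt_top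
  · refine (PnPULA.tvDist_le hdist).trans ?_
    rw [PnPULA.posteriorL2_eq hint, ← mul_assoc, ENNReal.ofReal_mul (by positivity)]
    exact le_self_add
  · have h1 := PnPULA.wasserstein_le
      (fun A hA => PnPULA.measure_le_add_of_abs_integral_sub_le hdist hA)
      ((hπ 0).lintegral_norm_sq_le (hcontr 0) (hK 0))
      ((hπ 1).lintegral_norm_sq_le (hcontr 1) (hK 1))
    refine h1.trans (le_of_eq_of_le ?_ le_self_add)
    rw [PnPULA.posteriorL2_eq hint, ENNReal.ofReal_mul hC0,
      ENNReal.mul_rpow_of_nonneg _ _ (by norm_num), ← mul_assoc, ← mul_assoc]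
    congr 1
    have hQ0 : 0 ≤ Q := PnPULA.momentBound_nonneg (by positivity)
    rw [ENNReal.ofReal_rpow_of_nonneg hQ0 (by norm_num),
      ENNReal.ofReal_rpow_of_nonneg hC0 (by norm_num), ← Real.sqrt_eq_rpow, ← Real.sqrt_eq_rpow,
      mul_assoc]
    change _ = ENNReal.ofReal (2 * (√Q * √C))
    rw [ENNReal.ofReal_mul (by norm_num), ENNReal.ofReal_mul (Real.sqrt_nonneg _),
      ENNReal.ofReal_ofNat]
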